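/- Let $\mathbb K\in\{\mathbb R,\mathbb C\}$. A *locally convex space* is a Hausdorff locally convex topological $\mathbb K$-vector space, and a *commutative locally convex algebra* is a commutative unital associative $\mathbb K$-algebra with a locally convex topology for which multiplication is jointly continuous. A map $f$ from an open subset $U$ of a locally convex space $E$ to a locally convex space $F$ is $C^\infty_{\mathbb K}$ if all iterated directional derivatives $d^{(k)}f(x,y_1,\dots,y_k)=(D_{y_k}\cdots D_{y_1}f)(x)$ exist and are continuous on $U\times E^k$; it is *$\mathbb K$-analytic* if it is $C^\infty_{\mathbb C}$ (for $\mathbb K=\mathbb C$), respectively if it extends to a $C^\infty_{\mathbb C}$-map from an open neighbourhood of $U$ in $E_{\mathbb C}$ to $F_{\mathbb C}$ (for $\mathbb K=\mathbb R$). $\mathbb K$-analytic manifolds and Lie groups modelled on a locally convex space are defined by means of this notion. Let $H$ be a Hopf algebra over $\mathbb K$ with a grading $H=\bigoplus_{n\ge 0}H_n$ such that $1\in H_0$, $H_nH_m\subseteq H_{n+m}$, $\Delta(H_n)\subseteq\bigoplus_{i+j=n}H_i\otimes H_j$, $\bigoplus_{n\ge1}H_n\subseteq\ker\epsilon$ and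 $\dim H_0=1$. Let $B$ be a commutative locally convex algebra. Equip $A=\operatorname{Hom}_{\mathbb K}(H,B)$ with the convolution product $\phi\star\psi=m_B\circ(\phi\otimes\psi)\circ\Delta$ and the topology of pointwise convergence. Let $\operatorname{Char}(H,B)\subseteq A$ be the group (under $\star$) of unital algebra homomorphisms $H\to B$, and let $\mathfrak g(H,B)\subseteq A$ be the set of infinitesimal characters, i.e. of all $\phi\in A$ with $\phi(ab)=\epsilon(a)\phi(b)+\epsilon(b)\phi(a)$ for all $a,b\in H$, a Lie algebra with the bracket $[\phi,\psi]=\phi\star\psi-\psi\star\phi$. Both carry the topology of pointwise convergence. Then $\operatorname{Char}(H,B)$, with this topology, is a $\mathbb K$-analytic Lie group modelled on $\mathfrak g(H,B)$, and the inclusion $\iota\colon\operatorname{Char}(H,B)\to A$ is $\mathbb K$-analytic. Moreover: (i) The tangent map $T_1\iota$ induces an isomorphism of topological Lie algebras from the Lie algebra of $\operatorname{Char}(H,B)$ (the tangent space at the identity with the bracket of left invariant vector fields) onto $\mathfrak g(H,B)$ with the commutator bracket. (ii) $\operatorname{Char}(H,B)$ is a Baker–Campbell–Hausdorff Lie group,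 i.e. a $\mathbb K$-analytic Lie group with an exponential function that is a local $\mathbb K$-analytic diffeomorphism at $0$. It is exponential: its Lie group exponential map is a $\mathbb K$-analytic diffeomorphism from the whole Lie algebra onto $\operatorname{Char}(H,B)$, and under the identification in (i) it is given by the exponential series $\phi\mapsto\sum_{n\ge0}\frac1{n!}\phi^{\star n}$, which converges pointwise on $H$. (iii) If $H$ has countable dimension and $B$ is a Fréchet space, then the model space $\mathfrak g(H,B)$ is a Fréchet space. If $B$ is weakly complete, i.e. isomorphic as a topological vector space to $\mathbb K^I$ for some set $I$, then $\mathfrak g(H,B)$ is weakly complete as well. -/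

import Mathlib

open scoped TensorProduct Topology ContDiff
open Filter

noncomputable section

/-! ### Locally convex, Fréchet and weakly complete spaces over `K = ℝ` or `K = ℂ` -/

/-- A locally convex space over `K`: a Hausdorff topological `K`-vector space which is locally
convex as a real vector space (real scalars act through `ℝ → K`). -/
structure IsLocallyConvexTVS (K : Type*) [RCLike K] (E : Type*) [AddCommGroup E] [Module K E]
    [TopologicalSpace E] : Prop where
  topologicalAddGroup : IsTopologicalAddGroup E
  continuousSMul : ContinuousSMul K E
  t2 : T2Space E
  locallyConvex : letI : Module ℝ E := Module.compHom E (algebraMap ℝ K); LocallyConvexSpace ℝ E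

/-- A Fréchet space: a locally convex space which is metrizable and complete (for its
uniform structure as a topological group). -/
structure IsFrechet (K : Type*) [RCLike K] (E : Type*) [AddCommGroup E] [Module K E]
    [TopologicalSpace E] : Prop where
  isLocallyConvexTVS : IsLocallyConvexTVS K E
  metrizable : TopologicalSpace.MetrizableSpace E
  complete : ∃ _ : IsTopologicalAddGroup E,
    @CompleteSpace E (IsTopologicalAddGroup.rightUniformSpace E)

/-- A weakly complete space: one that is topologically isomorphic to a power `K ^ I`. -/
def IsWeaklyComplete.{u} (K : Type*) [RCLike K] (E : Type u) [AddCommGroup E] [Module K E]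
    [TopologicalSpace E] : Prop :=
  ∃ I : Type u, Nonempty (E ≃L[K] (I → K))

/-! ### Differential calculus in locally convex spaces -/

section Calculus

variable (K : Type*) [RCLike K]
  {E : Type*} [AddCommGroup E] [Module K E] [TopologicalSpace E]
  {F : Type*} [AddCommGroup F] [Module K F] [TopologicalSpace F]

/-- `v` is the directional derivative `lim_{t → 0} t⁻¹ (f (x + t h) - f x)`, `t ∈ K \ {0}`. -/
def HasDirDeriv (f : E → F) (x h : E) (v : F) : Prop :=
  Tendsto (fun t : K => t⁻¹ • (f (x + t • h) - f x)) (𝓝[≠] 0) (𝓝 v)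

/-- The directional derivative `df (x, h)` (meaningful where it exists). -/
def dirDeriv (f : E → F) (x h : E) : F :=
  limUnder (𝓝[≠] (0 : K)) (fun t : K => t⁻¹ • (f (x + t • h) - f x))

/-- `f` is of class `C^r` over `K` on the open set `U`, for `r ∈ {0, 1, …, ∞}`: the iterated
directional derivatives `d⁽ᵏ⁾f (x, y₁, …, y_k) = (D_{y_k} ⋯ D_{y₁} f) (x)`, here `D k x y`,
exist for `k ≤ r`, `x ∈ U`, and are jointly continuous on `U × E ^ k`. -/
def IsCkOn (r : ℕ∞) (f : E → F) (U : Set E) : Prop :=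
  ∃ D : (k : ℕ) → E → (Fin k → E) → F,
    (∀ x ∈ U, ∀ y, D 0 x y = f x) ∧
    (∀ k : ℕ, ((k + 1 : ℕ) : ℕ∞) ≤ r → ∀ x ∈ U, ∀ (y : Fin k → E) (h : E),
      HasDirDeriv K (fun x' => D k x' y) x h (D (k + 1) x (Fin.snoc y h))) ∧
    (∀ k : ℕ, (k : ℕ∞) ≤ r →
      ContinuousOn (fun p : E × (Fin k → E) => D k p.1 p.2) (U ×ˢ Set.univ))

end Calculus

/-- The complexification `E ⊕ i E` of a real vector space `E`, with the product topology.
(The scalar field `K` is only a parameter through which the real numbers act on `E`;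
the definition is used for `K = ℝ`.) -/
@[nolint unusedArguments]
def Complexification (K : Type*) [RCLike K] (E : Type*) [AddCommGroup E] [Module K E] : Type _ :=
  E × E

namespace Complexification

variable (K : Type*) [RCLike K] (E : Type*) [AddCommGroup E] [Module K E]

instance : AddCommGroup (Complexification K E) := inferInstanceAs (AddCommGroup (E × E))

instance [TopologicalSpace E] : TopologicalSpace (Complexification K E) :=
  inferInstanceAs (TopologicalSpace (E × E))

/-- `(a + i b) (x + i y) = (a x - b y) + i (a y + b x)`. -/
instance : SMul ℂ (Complexification K E) where
  smul z w := ((z.re : K) • w.1 - (z.im : K) • w.2, (z.re : K) • w.2 + (z.im : K) • w.1)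

variable {K E}

theorem smul_def (z : ℂ) (w : Complexification K E) :
    z • w = (((z.re : K) • w.1 - (z.im : K) • w.2, (z.re : K) • w.2 + (z.im : K) • w.1) : E × E) :=
  rfl

/-- The inclusion `x ↦ x + i 0`. -/
def ofReal (x : E) : Complexification K E := ((x, 0) : E × E)

instance : Module ℂ (Complexification K E) where
  one_smul w := by
    rw [smul_def]
    refine Prod.ext ?_ ?_ <;> simp
  mul_smul z z' w := by
    simp only [smul_def]
    refine Prod.ext ?_ ?_
    · change ((z * z').re : K) • w.1 - ((z * z').im : K) • w.2 =
        (z.re : K) • ((z'.re : K) • w.1 - (z'.im : K) • w.2) -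
          (z.im : K) • ((z'.re : K) • w.2 + (z'.im : K) • w.1)
      simp only [Complex.mul_re, Complex.mul_im, RCLike.ofReal_add, RCLike.ofReal_sub,
        RCLike.ofReal_mul]
      module
    · change ((z * z').re : K) • w.2 + ((z * z').im : K) • w.1 =
        (z.re : K) • ((z'.re : K) • w.2 + (z'.im : K) • w.1) +
          (z.im : K) • ((z'.re : K) • w.1 - (z'.im : K) • w.2)
      simp only [Complex.mul_re, Complex.mul_im, RCLike.ofReal_add, RCLike.ofReal_sub,
        RCLike.ofReal_mul]
      module
  smul_zero z := by
    rw [smul_def]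
    refine Prod.ext ?_ ?_ <;>
      simp [show (0 : Complexification K E) = ((0, 0) : E × E) from rfl]
  smul_add z w w' := by
    simp only [smul_def]
    refine Prod.ext ?_ ?_
    · change (z.re : K) • (w.1 + w'.1) - (z.im : K) • (w.2 + w'.2) =
        ((z.re : K) • w.1 - (z.im : K) • w.2) + ((z.re : K) • w'.1 - (z.im : K) • w'.2)
      module
    · change (z.re : K) • (w.2 + w'.2) + (z.im : K) • (w.1 + w'.1) =
        ((z.re : K) • w.2 + (z.im : K) • w.1) + ((z.re : K) • w'.2 + (z.im : K) • w'.1)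
      module
  add_smul z z' w := by
    simp only [smul_def]
    refine Prod.ext ?_ ?_
    · change ((z + z').re : K) • w.1 - ((z + z').im : K) • w.2 =
        ((z.re : K) • w.1 - (z.im : K) • w.2) + ((z'.re : K) • w.1 - (z'.im : K) • w.2)
      simp only [Complex.add_re, Complex.add_im, RCLike.ofReal_add]
      module
    · change ((z + z').re : K) • w.2 + ((z + z').im : K) • w.1 =
        ((z.re : K) • w.2 + (z.im : K) • w.1) + ((z'.re : K) • w.2 + (z'.im : K) • w.1)
      simp only [Complex.add_re, Complex.add_im, RCLike.ofReal_add]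
      module
  zero_smul w := by
    rw [smul_def]
    refine Prod.ext ?_ ?_ <;>
      simp [show (0 : Complexification K E) = ((0, 0) : E × E) from rfl]

end Complexification

section Analytic

variable (K : Type*) [RCLike K]
  {E : Type*} [AddCommGroup E] [Module K E] [TopologicalSpace E]
  {F : Type*} [AddCommGroup F] [Module K F] [TopologicalSpace F]

/-- `f` is `K`-analytic on the open set `U`. For `K = ℂ` (that is, `i ≠ 0` in `K`) this means
of class `C^∞` over `ℂ`; for `K = ℝ` it means that `f` extends to a map of class `C^∞` over `ℂ`
on an open neighbourhood of `U` in the complexification of `E`. -/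
def IsKAnalyticOn (f : E → F) (U : Set E) : Prop :=
  ((RCLike.I : K) ≠ 0 → IsCkOn K ⊤ f U) ∧
  ((RCLike.I : K) = 0 →
    ∃ (V : Set (Complexification K E)) (g : Complexification K E → Complexification K F),
      IsOpen V ∧ (∀ x ∈ U, Complexification.ofReal x ∈ V) ∧
      (∀ x ∈ U, g (Complexification.ofReal x) = Complexification.ofReal (f x)) ∧
      IsCkOn ℂ ⊤ g V)

/-- `f` is of class `C^r` over `K` on the open set `U`, `r ∈ {0, 1, …, ∞, ω}`; `C^ω` means
`K`-analytic. -/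
def IsClassOn (r : WithTop ℕ∞) (f : E → F) (U : Set E) : Prop :=
  (∀ s : ℕ∞, r = (s : WithTop ℕ∞) → IsCkOn K s f U) ∧ (r = ω → IsKAnalyticOn K f U)

end Analytic

/-! ### Manifolds and Lie groups modelled on locally convex spaces -/

section Manifold

variable (K : Type*) [RCLike K]
  (E : Type*) [AddCommGroup E] [Module K E] [TopologicalSpace E]
  (F : Type*) [AddCommGroup F] [Module K F] [TopologicalSpace F]

/-- `f : M → N` is of class `C^r` on the open subset `S` of `M`: it is continuous there and is of
class `C^r` in all charts of the given atlases. -/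
def IsClassMapOn {M : Type*} [TopologicalSpace M] [ChartedSpace E M]
    {N : Type*} [TopologicalSpace N] [ChartedSpace F N]
    (r : WithTop ℕ∞) (f : M → N) (S : Set M) : Prop :=
  ContinuousOn f S ∧
  ∀ e ∈ atlas E M, ∀ e' ∈ atlas F N,
    IsClassOn K r (fun x => e' (f (e.symm x)))
      (e.target ∩ {x | e.symm x ∈ S ∧ f (e.symm x) ∈ e'.source})

/-- A `K`-analytic manifold modelled on the locally convex space `E`: a Hausdorff space with an
atlas of `E`-charts whose changes of charts are `K`-analytic. -/
structure IsKAnalyticManifold (M : Type*) [TopologicalSpace M] [ChartedSpace E M] : Prop where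
  model : IsLocallyConvexTVS K E
  t2 : T2Space M
  compatible : ∀ e ∈ atlas E M, ∀ e' ∈ atlas E M,
    IsClassOn K ω (fun x => e' (e.symm x)) (e.target ∩ {x | e.symm x ∈ e'.source})

/-- A `K`-analytic Lie group: a topological group with a structure of `K`-analytic manifold
such that multiplication and inversion are `K`-analytic. The clause on multiplication is
analyticity in the product charts `e₁ × e₂` of the manifold `G × G`. -/
structure IsKAnalyticLieGroup (G : Type*) [Group G] [TopologicalSpace G] [ChartedSpace E G] :
    Prop where
  manifold : IsKAnalyticManifold K E G
  topologicalGroup : IsTopologicalGroup G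
  analytic_mul : ∀ e₁ ∈ atlas E G, ∀ e₂ ∈ atlas E G, ∀ e₃ ∈ atlas E G,
    IsClassOn K ω (fun p : E × E => e₃ (e₁.symm p.1 * e₂.symm p.2))
      ((e₁.target ×ˢ e₂.target) ∩ {p | e₁.symm p.1 * e₂.symm p.2 ∈ e₃.source})
  analytic_inv : IsClassMapOn K E E ω (fun g : G => g⁻¹) Set.univ

/-- A `K`-analytic diffeomorphism between open subsets of manifolds. -/
def IsKAnalyticDiffeo {M : Type*} [TopologicalSpace M] [ChartedSpace E M]
    {N : Type*} [TopologicalSpace N] [ChartedSpace F N]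
    (f : M → N) (S : Set M) (T : Set N) : Prop :=
  IsOpen S ∧ IsOpen T ∧ ∃ g : N → M, Set.InvOn g f S T ∧ Set.MapsTo f S T ∧ Set.MapsTo g T S ∧
    IsClassMapOn K E F ω f S ∧ IsClassMapOn K F E ω g T

end Manifold

section LieGroup

variable (K : Type*) [RCLike K]
  (E : Type*) [AddCommGroup E] [Module K E] [TopologicalSpace E]
  (G : Type*) [Group G] [TopologicalSpace G] [ChartedSpace E G]

/-- The tangent space `T₁G` of a Lie group at the identity, identified with the model space `E`
through the preferred chart at `1`: the vector `v` is the velocity at `t = 0` of the curve that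
in this chart reads `t ↦ e 1 + t v`. -/
@[nolint unusedArguments]
abbrev TangentAtOne (E : Type*) (G : Type*) [Group G] [TopologicalSpace G]
    [TopologicalSpace E] [ChartedSpace E G] : Type _ := E

/-- The Lie bracket of vector fields on an open subset of `E`, at the point `x`:
`[X, Y](x) = dY (x, X x) - dX (x, Y x)`. -/
def fieldBracket {E : Type*} [AddCommGroup E] [Module K E] [TopologicalSpace E]
    (X Y : E → E) (x : E) : E :=
  dirDeriv K Y x (X x) - dirDeriv K X x (Y x)

/-- The left invariant vector field `g ↦ T₁(λ_g) v` on `G`, `λ_g` the left translation by `g`,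
written in the preferred chart `e` at `1`. -/
def leftInvariantField (v : TangentAtOne E G) : E → E := fun x =>
  dirDeriv K (fun y => chartAt E (1 : G) ((chartAt E (1 : G)).symm x * (chartAt E (1 : G)).symm y))
    (chartAt E (1 : G) 1) v

/-- The Lie bracket of the Lie algebra of `G`: the value at `1` of the bracket of the left
invariant vector fields with values `v` and `w` at `1`. -/
def lieGroupBracket (v w : TangentAtOne E G) : TangentAtOne E G :=
  fieldBracket K (leftInvariantField K E G v) (leftInvariantField K E G w) (chartAt E (1 : G) 1)

variable {G}

/-- A map `exp : T₁G → G` is an exponential function of `G` if it is smooth and if for each `v`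
the curve `t ↦ exp (t v)`, `t ∈ ℝ`, is a one-parameter group with velocity `v` at `t = 0`. -/
structure IsLieExponential (exp : TangentAtOne E G → G) : Prop where
  smooth : IsClassMapOn K E E ∞ exp Set.univ
  add : ∀ (v : E) (s t : ℝ), exp (((s + t : ℝ) : K) • v) = exp ((s : K) • v) * exp ((t : K) • v)
  deriv : ∀ v : E, Tendsto
    (fun t : ℝ => (((t : ℝ) : K)⁻¹) • (chartAt E (1 : G) (exp ((t : K) • v)) - chartAt E (1 : G) 1))
    (𝓝[≠] 0) (𝓝 v)

variable (G)

/-- A Baker--Campbell--Hausdorff Lie group: a `K`-analytic Lie group with an exponential function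
that is a `K`-analytic diffeomorphism from a neighbourhood of `0` onto a neighbourhood of `1`. -/
def IsBCHLieGroup : Prop :=
  IsKAnalyticLieGroup K E G ∧
  ∃ exp : TangentAtOne E G → G, IsLieExponential K E exp ∧
    ∃ (S : Set E) (T : Set G), (0 : E) ∈ S ∧ IsKAnalyticDiffeo K E E exp S T

end LieGroup

/-! ### Graded connected Hopf algebras -/

/-- `𝒜` is an `ℕ`-grading of the Hopf algebra `H`, as an algebra and as a coalgebra, and `H` is
connected with respect to it. -/
structure IsConnectedHopfGrading {K : Type*} [RCLike K] {H : Type*} [Ring H] [HopfAlgebra K H]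
    (𝒜 : ℕ → Submodule K H) : Prop where
  isInternal : DirectSum.IsInternal 𝒜
  one_mem : (1 : H) ∈ 𝒜 0
  mul_mem : ∀ {m n : ℕ} {a b : H}, a ∈ 𝒜 m → b ∈ 𝒜 n → a * b ∈ 𝒜 (m + n)
  comul_mem : ∀ {n : ℕ} {a : H}, a ∈ 𝒜 n → Coalgebra.comul (R := K) a ∈
    ⨆ p ∈ Finset.HasAntidiagonal.antidiagonal n,
      LinearMap.range (TensorProduct.map (𝒜 p.1).subtype (𝒜 p.2).subtype)
  counit_eq_zero : ∀ {n : ℕ} {a : H}, 1 ≤ n → a ∈ 𝒜 n → Coalgebra.counit (R := K) a = 0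
  connected : Module.finrank K (𝒜 0) = 1

/-! ### The convolution algebra, characters and infinitesimal characters -/

section Characters

variable (K : Type*) [RCLike K] (H : Type*) [Ring H] [HopfAlgebra K H]
  (B : Type*) [CommRing B] [Algebra K B]

/-- The algebra `Hom_K (H, B)` of linear maps with the convolution product. -/
abbrev ConvAlg : Type _ := WithConv (H →ₗ[K] B)

/-- The topology of pointwise convergence on `Hom_K (H, B)`. -/
instance ConvAlg.instTopologicalSpace [TopologicalSpace B] : TopologicalSpace (ConvAlg K H B) :=
  TopologicalSpace.induced (fun (φ : ConvAlg K H B) (a : H) => φ a) inferInstance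

/-- `Hom_K (H, B)` is a Lie algebra with the commutator bracket `φ ⋆ ψ - ψ ⋆ φ`. -/
instance ConvAlg.instLieRing : LieRing (ConvAlg K H B) := LieRing.ofAssociativeRing

instance ConvAlg.instLieAlgebra : LieAlgebra K (ConvAlg K H B) := LieAlgebra.ofAssociativeAlgebra

theorem ConvAlg.lie_def (φ ψ : ConvAlg K H B) : ⁅φ, ψ⁆ = φ * ψ - ψ * φ := rfl

/-- The set of `B`-valued characters (unital algebra homomorphisms `H → B`). -/
def CharGroup : Type _ := WithConv (H →ₐ[K] B)

variable {K H B} in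
open Coalgebra in
theorem ConvAlg.mul_apply_mul {φ ψ : ConvAlg K H B}
    (hφ : ∀ a b : H, φ (a * b) = counit (R := K) a • φ b + counit (R := K) b • φ a)
    (hψ : ∀ a b : H, ψ (a * b) = counit (R := K) a • ψ b + counit (R := K) b • ψ a) (a b : H) :
    (φ * ψ) (a * b) = counit (R := K) a • (φ * ψ) b + counit (R := K) b • (φ * ψ) a +
      (φ a * ψ b + φ b * ψ a) := by
  have h1 (χ : ConvAlg K H B) (c : H) :
      ∑ i ∈ (ℛ K c).index, counit (R := K) ((ℛ K c).left i) • χ ((ℛ K c).right i) = χ c := by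
    conv_rhs => rw [← sum_counit_smul (ℛ K c)]
    simp
  have h2 (χ : ConvAlg K H B) (c : H) :
      ∑ i ∈ (ℛ K c).index, counit (R := K) ((ℛ K c).right i) • χ ((ℛ K c).left i) = χ c := by
    have := congrArg (TensorProduct.rid K H) (sum_tmul_counit_eq (ℛ K c))
    conv_rhs => rw [← show _ = c by simpa [-sum_tmul_counit_eq] using this]
    simp
  have h3 (c : H) : ∑ i ∈ (ℛ K c).index,
      counit (R := K) ((ℛ K c).left i) * counit (R := K) ((ℛ K c).right i) = counit (R := K) c := by
    conv_rhs => rw [← sum_counit_smul (ℛ K c)]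
    simp
  have key (i : _) (j : _) :
      φ ((ℛ K a).left i * (ℛ K b).left j) * ψ ((ℛ K a).right i * (ℛ K b).right j) =
      (counit (R := K) ((ℛ K a).left i) * counit (R := K) ((ℛ K a).right i)) •
          (φ ((ℛ K b).left j) * ψ ((ℛ K b).right j)) +
        (counit (R := K) ((ℛ K b).left j) * counit (R := K) ((ℛ K b).right j)) •
          (φ ((ℛ K a).left i) * ψ ((ℛ K a).right i)) +
        ((counit (R := K) ((ℛ K a).right i) • φ ((ℛ K a).left i)) *
            (counit (R := K) ((ℛ K b).left j) • ψ ((ℛ K b).right j)) +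
          (counit (R := K) ((ℛ K b).right j) • φ ((ℛ K b).left j)) *
            (counit (R := K) ((ℛ K a).left i) • ψ ((ℛ K a).right i))) := by
    rw [hφ, hψ]
    simp only [Algebra.smul_def, map_mul]
    ring
  rw [((ℛ K a).mul (ℛ K b)).convMul_apply, (ℛ K a).convMul_apply, (ℛ K b).convMul_apply,
    ← h3 a, ← h3 b, ← h2 φ a, ← h1 ψ b, ← h2 φ b, ← h1 ψ a]
  change ∑ x ∈ (ℛ K a).index ×ˢ (ℛ K b).index,
    φ ((ℛ K a).left x.1 * (ℛ K b).left x.2) * ψ ((ℛ K a).right x.1 * (ℛ K b).right x.2) = _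
  simp only [key, Finset.sum_add_distrib]
  congr 1
  · congr 1
    · rw [Finset.sum_smul_sum, Finset.sum_product]
    · rw [Finset.sum_smul_sum, Finset.sum_product_right]
  · congr 1
    · rw [Finset.sum_mul_sum, Finset.sum_product]
    · rw [Finset.sum_mul_sum, Finset.sum_product_right]

/-- The Lie algebra of infinitesimal characters, with the commutator bracket of the convolution
product. -/
def InfChar : LieSubalgebra K (ConvAlg K H B) where
  carrier := {φ | ∀ a b : H, φ (a * b) =
    Coalgebra.counit (R := K) a • φ b + Coalgebra.counit (R := K) b • φ a}
  zero_mem' := by intro a b; simp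
  add_mem' := by
    intro φ ψ hφ hψ a b
    simp only [Set.mem_ofPred_eq] at hφ hψ
    simp only [WithConv.ofConv_add, LinearMap.add_apply, hφ, hψ, smul_add]
    abel
  smul_mem' := by
    intro c φ hφ a b
    simp only [Set.mem_ofPred_eq] at hφ
    simp only [WithConv.ofConv_smul, LinearMap.smul_apply, hφ, smul_add, smul_comm c]
  lie_mem' := by
    intro φ ψ hφ hψ a b
    simp only [ConvAlg.lie_def, WithConv.ofConv_sub, LinearMap.sub_apply,
      ConvAlg.mul_apply_mul hφ hψ, ConvAlg.mul_apply_mul hψ hφ, smul_sub]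
    ring

variable {K H B}

namespace CharGroup

/-- A character, as an element of the convolution algebra. -/
def toConvAlg (φ : CharGroup K H B) : ConvAlg K H B :=
  WithConv.toConv (WithConv.ofConv (A := H →ₐ[K] B) φ).toLinearMap

/-- The topology of pointwise convergence. -/
instance [TopologicalSpace B] : TopologicalSpace (CharGroup K H B) :=
  TopologicalSpace.induced toConvAlg inferInstance

/-- The convolution product. -/
instance : Monoid (CharGroup K H B) := inferInstanceAs (Monoid (WithConv (H →ₐ[K] B)))

theorem toConvAlg_injective : Function.Injective (toConvAlg (K := K) (H := H) (B := B)) :=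
  WithConv.toConv_injective.comp (AlgHom.toLinearMap_injective.comp WithConv.ofConv_injective)

theorem toConvAlg_one : toConvAlg (1 : CharGroup K H B) = 1 := rfl

theorem toConvAlg_mul (φ ψ : CharGroup K H B) :
    toConvAlg (φ * ψ) = toConvAlg φ * toConvAlg ψ := rfl

/-- The inverse of a character is its composition with the antipode. -/
instance : Inv (CharGroup K H B) where
  inv φ := WithConv.toConv (A := H →ₐ[K] B) <| AlgHom.ofLinearMap
    ((toConvAlg φ).ofConv ∘ₗ HopfAlgebra.antipode K (A := H))
    (by simp [toConvAlg])
    (by intro a b; simp [toConvAlg, HopfAlgebra.antipode_mul_antidistrib, mul_comm])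

instance : Group (CharGroup K H B) where
  inv_mul_cancel φ := by
    apply toConvAlg_injective
    have h := LinearMap.algHom_comp_convMul_distrib (WithConv.ofConv (A := H →ₐ[K] B) φ)
      (WithConv.toConv (HopfAlgebra.antipode K (A := H))) (WithConv.toConv LinearMap.id)
    rw [LinearMap.antipode_mul_id] at h
    apply WithConv.ofConv_injective
    refine h.symm.trans ?_
    ext a
    simp [toConvAlg_one]

end CharGroup

end Characters

end

/-!
The proof rests on two observations about `A = Hom_K (H, B)` with its convolution product.

**Everything is pointwise polynomial.** By connectedness, the linear maps vanishing in all degrees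
below `k` form a multiplicative filtration of `A` (`vanishBelow`, `mul_mem_vanishBelow`), and each
`a : H` is annihilated by a late enough step of it. A linear map `φ` with `φ 1 = 0` lies in the
first step, so at every `a` the exponential series of `φ` is a finite sum. If `φ` and `φ'` agree
below degree `k`, then `convExp φ - convExp φ'` and `φ - φ'` agree in degree `k` as well
(`convExp_sub_convExp_mem`). Hence `convExp` is a bijection from this step onto the maps with value
`1` at `1`, and its inverse `convLog` is obtained by successive approximation, where again each
value is reached after finitely many steps. So for each `a`, the
values at `a` of exponential, logarithm and convolution are polynomials in continuous linear forms
(`IsPointwisePoly`).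

**The target spaces are powers of `B`.** Infinitesimal characters are the linear maps vanishing at
`1` and on the square of the augmentation ideal, hence correspond to arbitrary families in `B`
indexed by a basis of a quotient of `H` (`InfChar.exists_equiv_pi`). This gives the assertions on
Fréchet and weakly complete spaces. It also reduces analyticity to that of single components:
polynomial maps into `B` have polynomial derivatives of all orders and extend to complexifications,
and as the components in `B ^ ι` are unrelated, the extensions of the components combine to an
extension of the map (`isKAnalyticOn_of_isPolyMap`).

The exponential of an infinitesimal character is a character by the Leibniz rule for divided powers
(`convExp_apply_mul`). Conversely, if `φ` is the logarithm of a character, then `exp (n φ)` is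
multiplicative for all natural numbers `n`; comparing the linear coefficients of polynomials in `n`
shows that `φ` is infinitesimal (`convLog_mem_infChar`). Thus `charExp` is a homeomorphism, and its
inverse is used as the only chart of the group. In this chart the exponential map and its inverse
are the identity, inversion is `x ↦ -x`, and the multiplication `bchMul` is pointwise polynomial.
The Lie bracket is read off from the coefficient of `s t` in `bchMul (s v) (t w)`, which a
comparison of second order terms identifies as half the commutator of `v` and `w`
(`bchMul_mixed_term`).
-/

noncomputable section

/-! ### Polynomial maps and their directional derivatives -/

/-- The polynomial maps on a topological vector space `E` with values in a commutative
algebra `B`: the subalgebra of `E → B` generated by the constants and the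
continuous linear maps. -/
inductive IsPolyMap (K : Type*) [RCLike K] {E : Type*} [AddCommGroup E] [Module K E]
    [TopologicalSpace E] {B : Type*} [CommRing B] [Algebra K B] [TopologicalSpace B] :
    (E → B) → Prop
  | const (b : B) : IsPolyMap K fun _ => b
  | clm (l : E →L[K] B) : IsPolyMap K fun x => l x
  | add {f g : E → B} : IsPolyMap K f → IsPolyMap K g → IsPolyMap K fun x => f x + g x
  | mul {f g : E → B} : IsPolyMap K f → IsPolyMap K g → IsPolyMap K fun x => f x * g x

namespace IsPolyMap

variable {K : Type*} [RCLike K] {E : Type*} [AddCommGroup E] [Module K E]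
  [TopologicalSpace E] {X : Type*} [AddCommGroup X] [Module K X] [TopologicalSpace X]
  {B : Type*} [CommRing B] [Algebra K B] [TopologicalSpace B] {f g : E → B}

theorem smul (c : K) (hf : IsPolyMap K f) : IsPolyMap K fun x => c • f x := by
  simpa only [Algebra.smul_def] using (const (algebraMap K B c)).mul hf

theorem sub (hf : IsPolyMap K f) (hg : IsPolyMap K g) : IsPolyMap K fun x => f x - g x := by
  simpa [sub_eq_add_neg] using hf.add (hg.smul (-1))

theorem sum {ι : Type*} {s : Finset ι} {f : ι → E → B} (hf : ∀ i ∈ s, IsPolyMap K (f i)) :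
    IsPolyMap K fun x => ∑ i ∈ s, f i x := by
  classical
  induction s using Finset.induction_on with
  | empty => simpa using const 0
  | insert i s hi ih =>
    simp only [Finset.sum_insert hi]
    exact (hf i (Finset.mem_insert_self i s)).add
      (ih fun j hj => hf j (Finset.mem_insert_of_mem hj))

theorem comp_clm (hf : IsPolyMap K f) (T : X →L[K] E) : IsPolyMap K fun x => f (T x) := by
  induction hf with
  | const b => exact const b
  | clm l => exact clm (l.comp T)
  | add _ _ h₁ h₂ => exact h₁.add h₂
  | mul _ _ h₁ h₂ => exact h₁.mul h₂

theorem continuous [IsTopologicalRing B] (hf : IsPolyMap K f) : Continuous f := by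
  induction hf with
  | const b => exact continuous_const
  | clm l => exact l.continuous
  | add _ _ h₁ h₂ => exact h₁.add h₂
  | mul _ _ h₁ h₂ => exact h₁.mul h₂

end IsPolyMap

section DirDeriv

variable {K : Type*} [RCLike K] {E : Type*} [AddCommGroup E] [Module K E]
  {F : Type*} [AddCommGroup F] [Module K F] [TopologicalSpace F]

/-- A map is continuous along each line on which it has a directional derivative. -/
theorem HasDirDeriv.tendsto [IsTopologicalAddGroup F] [ContinuousSMul K F] {f : E → F} {x h : E}
    {v : F} (hf : HasDirDeriv K f x h v) :
    Tendsto (fun t : K => f (x + t • h)) (𝓝[≠] 0) (𝓝 (f x)) := by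
  have h1 : Tendsto (fun t : K => t • (t⁻¹ • (f (x + t • h) - f x)) + f x) (𝓝[≠] 0)
      (𝓝 ((0 : K) • v + f x)) :=
    ((tendsto_id.mono_left nhdsWithin_le_nhds).smul hf).add_const _
  rw [zero_smul, zero_add] at h1
  refine h1.congr' ?_
  filter_upwards [self_mem_nhdsWithin] with t ht
  rw [smul_inv_smul₀ ht, sub_add_cancel]

theorem HasDirDeriv.add [IsTopologicalAddGroup F] {f g : E → F} {x h : E}
    {v w : F} (hf : HasDirDeriv K f x h v) (hg : HasDirDeriv K g x h w) :
    HasDirDeriv K (fun x => f x + g x) x h (v + w) := by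
  refine (Tendsto.add hf hg).congr fun t => ?_
  rw [← smul_add, add_sub_add_comm]

theorem HasDirDeriv.mul {B : Type*} [CommRing B] [Algebra K B] [TopologicalSpace B]
    [IsTopologicalRing B] [ContinuousSMul K B] {f g : E → B} {x h : E}
    {v w : B} (hf : HasDirDeriv K f x h v) (hg : HasDirDeriv K g x h w) :
    HasDirDeriv K (fun x => f x * g x) x h (v * g x + f x * w) := by
  refine ((Tendsto.mul hf hg.tendsto).add (Tendsto.const_mul (f x) hg)).congr fun t => ?_
  simp only [Algebra.smul_def]
  ring

theorem hasDirDeriv_const (c : F) (x h : E) : HasDirDeriv K (fun _ => c) x h 0 := by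
  simp [HasDirDeriv, tendsto_const_nhds]

theorem HasDirDeriv.of_add_smul {f : E → F} {x h : E} {v : F}
    (hf : ∀ t : K, f (x + t • h) = f x + t • v) : HasDirDeriv K f x h v := by
  refine tendsto_const_nhds.congr' ?_
  filter_upwards [self_mem_nhdsWithin] with t ht
  rw [hf, add_sub_cancel_left, inv_smul_smul₀ ht]

theorem hasDirDeriv_linear (l : E →ₗ[K] F) (x h : E) : HasDirDeriv K (fun y => l y) x h (l h) :=
  HasDirDeriv.of_add_smul fun t => by rw [map_add, map_smul]

theorem HasDirDeriv.dirDeriv_eq [T2Space F] {f : E → F} {x h : E} {v : F}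
    (hf : HasDirDeriv K f x h v) : dirDeriv K f x h = v :=
  Tendsto.limUnder_eq hf

end DirDeriv

section Smooth

variable {K : Type*} [RCLike K] {E : Type*} [AddCommGroup E] [Module K E]
  [TopologicalSpace E]
  {B : Type*} [CommRing B] [Algebra K B] [TopologicalSpace B]
  [IsTopologicalRing B] [ContinuousSMul K B]

/-- The directional derivative of a polynomial map is a polynomial map of the pair
(point, direction). -/
theorem IsPolyMap.exists_hasDirDeriv {f : E → B} (hf : IsPolyMap K f) :
    ∃ g : E × E → B, IsPolyMap K g ∧ ∀ x h, HasDirDeriv K f x h (g (x, h)) := by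
  induction hf with
  | const b => exact ⟨fun _ => 0, .const 0, hasDirDeriv_const b⟩
  | clm l =>
    exact ⟨_, .clm (l.comp (ContinuousLinearMap.snd K E E)),
      fun x h => hasDirDeriv_linear (l : E →ₗ[K] B) x h⟩
  | add _ _ h₁ h₂ =>
    obtain ⟨f', hf', hf⟩ := h₁
    obtain ⟨g', hg', hg⟩ := h₂
    exact ⟨_, hf'.add hg', fun x h => (hf x h).add (hg x h)⟩
  | @mul f g pf pg h₁ h₂ =>
    obtain ⟨f', hf', hf⟩ := h₁
    obtain ⟨g', hg', hg⟩ := h₂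
    exact ⟨_, (hf'.mul (pg.comp_clm (ContinuousLinearMap.fst K E E))).add
      ((pf.comp_clm (ContinuousLinearMap.fst K E E)).mul hg'), fun x h => (hf x h).mul (hg x h)⟩

/-- Given a polynomial map of `x` and `y : Fin k → E`, its derivative in `x` is a polynomial map
of `x` and `Fin.snoc y h`, where `h` is the direction. -/
theorem IsPolyMap.exists_partial_hasDirDeriv {k : ℕ} {f : E × (Fin k → E) → B}
    (hf : IsPolyMap K f) :
    ∃ g : E × (Fin (k + 1) → E) → B, IsPolyMap K g ∧ ∀ x y h,
      HasDirDeriv K (fun x' => f (x', y)) x h (g (x, Fin.snoc y h)) := by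
  obtain ⟨g, hg, hfg⟩ := hf.exists_hasDirDeriv
  let π (j : Fin (k + 1)) : E × (Fin (k + 1) → E) →L[K] E :=
    (ContinuousLinearMap.proj j).comp (ContinuousLinearMap.snd K E (Fin (k + 1) → E))
  let T : E × (Fin (k + 1) → E) →L[K] (E × (Fin k → E)) × (E × (Fin k → E)) :=
    ((ContinuousLinearMap.fst K E _).prod (ContinuousLinearMap.pi fun j => π j.castSucc)).prod
      ((π (Fin.last k)).prod 0)
  refine ⟨_, hg.comp_clm T, fun x y h => ?_⟩
  have hT : T (x, Fin.snoc y h) = ((x, y), (h, 0)) := by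
    refine Prod.ext (Prod.ext rfl (funext fun j => ?_)) (Prod.ext ?_ rfl)
    · exact Fin.snoc_castSucc (α := fun _ => E) h y j
    · exact Fin.snoc_last (α := fun _ => E) h y
  rw [hT]
  refine (hfg (x, y) (h, 0)).congr fun t => ?_
  simp

/-- A polynomial map has iterated directional derivatives of all orders, which are polynomial. -/
theorem IsPolyMap.exists_iterated {f : E → B} (hf : IsPolyMap K f) :
    ∃ D : (k : ℕ) → E × (Fin k → E) → B,
      (∀ x y, D 0 (x, y) = f x) ∧ (∀ k, IsPolyMap K (D k)) ∧
      ∀ k x y h, HasDirDeriv K (fun x' => D k (x', y)) x h (D (k + 1) (x, Fin.snoc y h)) := by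
  choose d hd hd' using fun (k : ℕ) (f : {f : E × (Fin k → E) → B // IsPolyMap K f}) =>
    f.2.exists_partial_hasDirDeriv
  let D (k : ℕ) : {f : E × (Fin k → E) → B // IsPolyMap K f} :=
    Nat.rec ⟨_, hf.comp_clm (ContinuousLinearMap.fst K E _)⟩ (fun k f => ⟨d k f, hd k f⟩) k
  exact ⟨fun k => (D k).1, fun _ _ => rfl, fun k => (D k).2, fun k => hd' k (D k)⟩

/-- A map into a power of `B` with polynomial components is smooth. -/
theorem isCkOn_of_isPolyMap {F : Type*} [AddCommGroup F] [Module K F] [TopologicalSpace F]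
    {ι : Type*} (Φ : F ≃L[K] (ι → B)) {f : E → F} (hf : ∀ i, IsPolyMap K fun x => Φ (f x) i)
    (r : ℕ∞) (U : Set E) : IsCkOn K r f U := by
  choose D h0 hp hD using fun i => (hf i).exists_iterated
  refine ⟨fun k x y => Φ.symm fun i => D i k (x, y), fun x _ y => ?_, fun k _ x _ y h => ?_,
    fun k _ => Continuous.continuousOn ?_⟩
  · simp [h0]
  · have h1 : Tendsto (fun (t : K) (i : ι) => t⁻¹ • (D i k (x + t • h, y) - D i k (x, y))) (𝓝[≠] 0)
        (𝓝 fun i => D i (k + 1) (x, Fin.snoc y h)) :=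
      tendsto_pi_nhds.2 fun i => hD i k x y h
    refine ((Φ.symm.continuous.tendsto _).comp h1).congr fun t => ?_
    rw [← map_sub, ← map_smul]
    rfl
  · exact Φ.symm.continuous.comp (continuous_pi fun i => (hp i k).continuous)

end Smooth

/-! ### Complexification -/

namespace Complexification

variable {K : Type*} [RCLike K]

section Ring

variable {B : Type*} [CommRing B] [Algebra K B]

/-- `(a + i b) (c + i d) = (a c - b d) + i (a d + b c)`. -/
instance : Mul (Complexification K B) where
  mul z w := ((z.1 * w.1 - z.2 * w.2, z.1 * w.2 + z.2 * w.1) : B × B)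

instance : One (Complexification K B) where
  one := ((1, 0) : B × B)

theorem ext_fst_snd {E : Type*} [AddCommGroup E] [Module K E] {z w : Complexification K E}
    (h₁ : z.1 = w.1) (h₂ : z.2 = w.2) : z = w := Prod.ext h₁ h₂

theorem fst_add {E : Type*} [AddCommGroup E] [Module K E] (z w : Complexification K E) :
    (z + w).1 = z.1 + w.1 := rfl

theorem snd_add {E : Type*} [AddCommGroup E] [Module K E] (z w : Complexification K E) :
    (z + w).2 = z.2 + w.2 := rfl

theorem fst_smul {E : Type*} [AddCommGroup E] [Module K E] (c : ℂ) (z : Complexification K E) :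
    (c • z).1 = (c.re : K) • z.1 - (c.im : K) • z.2 := rfl

theorem snd_smul {E : Type*} [AddCommGroup E] [Module K E] (c : ℂ) (z : Complexification K E) :
    (c • z).2 = (c.re : K) • z.2 + (c.im : K) • z.1 := rfl

theorem fst_mul (z w : Complexification K B) : (z * w).1 = z.1 * w.1 - z.2 * w.2 := rfl

theorem snd_mul (z w : Complexification K B) : (z * w).2 = z.1 * w.2 + z.2 * w.1 := rfl

/-- The complexification of a commutative algebra is a commutative ring. -/
instance : CommRing (Complexification K B) where
  __ := (inferInstance : AddCommGroup (Complexification K B))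
  __ := (inferInstance : Mul (Complexification K B))
  __ := (inferInstance : One (Complexification K B))
  left_distrib x y z := by
    apply ext_fst_snd <;> simp only [fst_add, snd_add, fst_mul, snd_mul] <;> ring
  right_distrib x y z := by
    apply ext_fst_snd <;> simp only [fst_add, snd_add, fst_mul, snd_mul] <;> ring
  zero_mul x := ext_fst_snd (show (0 : B) * x.1 - 0 * x.2 = 0 by simp)
    (show (0 : B) * x.2 + 0 * x.1 = 0 by simp)
  mul_zero x := ext_fst_snd (show x.1 * (0 : B) - x.2 * 0 = 0 by simp)
    (show x.1 * (0 : B) + x.2 * 0 = 0 by simp)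
  mul_assoc x y z := by
    apply ext_fst_snd <;> simp only [fst_mul, snd_mul] <;> ring
  one_mul x := ext_fst_snd (show (1 : B) * x.1 - 0 * x.2 = x.1 by simp)
    (show (1 : B) * x.2 + 0 * x.1 = x.2 by simp)
  mul_one x := ext_fst_snd (show x.1 * (1 : B) - x.2 * 0 = x.1 by simp)
    (show x.1 * (0 : B) + x.2 * 1 = x.2 by simp)
  mul_comm x y := by
    apply ext_fst_snd <;> simp only [fst_mul, snd_mul] <;> ring

instance : Algebra ℂ (Complexification K B) :=
  Algebra.ofModule
    (fun c x y => by
      apply ext_fst_snd <;>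
        simp only [fst_mul, snd_mul, fst_smul, snd_smul, Algebra.smul_def] <;> ring)
    (fun c x y => by
      apply ext_fst_snd <;>
        simp only [fst_mul, snd_mul, fst_smul, snd_smul, Algebra.smul_def] <;> ring)

theorem ofReal_add {E : Type*} [AddCommGroup E] [Module K E] (x y : E) :
    (ofReal (x + y) : Complexification K E) = ofReal x + ofReal y :=
  Prod.ext rfl (add_zero (0 : E)).symm

theorem ofReal_mul (x y : B) : (ofReal (x * y) : Complexification K B) = ofReal x * ofReal y :=
  ext_fst_snd (show x * y = x * y - 0 * 0 by simp) (show (0 : B) = x * 0 + 0 * y by simp)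

end Ring

section Topology

variable {E : Type*} [AddCommGroup E] [Module K E] [TopologicalSpace E]
  {F : Type*} [AddCommGroup F] [Module K F] [TopologicalSpace F]
  {B : Type*} [CommRing B] [Algebra K B] [TopologicalSpace B]

theorem continuous_fst : Continuous fun z : Complexification K E => z.1 :=
  _root_.continuous_fst

theorem continuous_snd : Continuous fun z : Complexification K E => z.2 :=
  _root_.continuous_snd

instance [IsTopologicalRing B] : IsTopologicalRing (Complexification K B) where
  continuous_add := (inferInstance : ContinuousAdd (B × B)).continuous_add
  continuous_neg := (inferInstance : ContinuousNeg (B × B)).continuous_neg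
  continuous_mul := by
    have h1 : Continuous fun p : (B × B) × (B × B) =>
      (p.1.1 * p.2.1 - p.1.2 * p.2.2, p.1.1 * p.2.2 + p.1.2 * p.2.1) := by fun_prop
    exact h1

instance [IsTopologicalAddGroup E] [ContinuousSMul K E] :
    ContinuousSMul ℂ (Complexification K E) where
  continuous_smul := by
    have h1 : Continuous fun p : ℂ × (E × E) =>
        ((p.1.re : K) • p.2.1 - (p.1.im : K) • p.2.2,
          (p.1.re : K) • p.2.2 + (p.1.im : K) • p.2.1) := by
      have hr : Continuous fun p : ℂ × (E × E) => (p.1.re : K) :=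
        RCLike.continuous_ofReal.comp (Complex.continuous_re.comp _root_.continuous_fst)
      have hi : Continuous fun p : ℂ × (E × E) => (p.1.im : K) :=
        RCLike.continuous_ofReal.comp (Complex.continuous_im.comp _root_.continuous_fst)
      fun_prop
    exact h1

/-- The complexification of a continuous linear map. -/
def mapL (l : E →L[K] F) : Complexification K E →L[ℂ] Complexification K F where
  toFun z := ((l z.1, l z.2) : F × F)
  map_add' z w := ext_fst_snd (map_add l z.1 w.1) (map_add l z.2 w.2)
  map_smul' c z :=
    ext_fst_snd (show l ((c.re : K) • z.1 - (c.im : K) • z.2) =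
        (c.re : K) • l z.1 - (c.im : K) • l z.2 by simp only [map_sub, map_smul])
      (show l ((c.re : K) • z.2 + (c.im : K) • z.1) =
        (c.re : K) • l z.2 + (c.im : K) • l z.1 by simp only [map_add, map_smul])
  cont := by
    have h1 : Continuous fun z : E × E => (l z.1, l z.2) := by fun_prop
    exact h1

theorem mapL_ofReal (l : E →L[K] F) (x : E) : mapL l (ofReal x) = ofReal (l x) :=
  Prod.ext rfl (map_zero l)

/-- The complexification of a power of `F` is the same power of the complexification. -/
def piEquiv (ι : Type*) : Complexification K (ι → F) ≃L[ℂ] (ι → Complexification K F) where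
  toFun z i := ((z.1 i, z.2 i) : F × F)
  invFun w := ((fun i => (w i).1, fun i => (w i).2) : (ι → F) × (ι → F))
  left_inv _ := rfl
  right_inv _ := rfl
  map_add' _ _ := rfl
  map_smul' _ _ := rfl
  continuous_toFun := continuous_pi fun i =>
    ((continuous_apply i).comp continuous_fst).prodMk ((continuous_apply i).comp continuous_snd)
  continuous_invFun :=
    (continuous_pi fun i => continuous_fst.comp (continuous_apply i)).prodMk
      (continuous_pi fun i => continuous_snd.comp (continuous_apply i))

/-- The complexification of a continuous linear equivalence. -/
def congr (Φ : E ≃L[K] F) : Complexification K E ≃L[ℂ] Complexification K F :=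
  ContinuousLinearEquiv.equivOfInverse (mapL (Φ : E →L[K] F)) (mapL (Φ.symm : F →L[K] E))
    (fun _ => Prod.ext (Φ.symm_apply_apply _) (Φ.symm_apply_apply _))
    (fun _ => Prod.ext (Φ.apply_symm_apply _) (Φ.apply_symm_apply _))

end Topology

end Complexification

section Analytic

variable {K : Type*} [RCLike K] {E : Type*} [AddCommGroup E] [Module K E]
  [TopologicalSpace E]
  {B : Type*} [CommRing B] [Algebra K B] [TopologicalSpace B]

/-- A polynomial map extends to a polynomial map between the complexifications. -/
theorem IsPolyMap.exists_complexification {f : E → B} (hf : IsPolyMap K f) :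
    ∃ g : Complexification K E → Complexification K B, IsPolyMap ℂ g ∧
      ∀ x, g (Complexification.ofReal x) = Complexification.ofReal (f x) := by
  induction hf with
  | const b => exact ⟨_, .const (Complexification.ofReal b), fun _ => rfl⟩
  | clm l => exact ⟨_, .clm (Complexification.mapL l), Complexification.mapL_ofReal l⟩
  | add _ _ h₁ h₂ =>
    obtain ⟨f', hf', hf⟩ := h₁
    obtain ⟨g', hg', hg⟩ := h₂
    exact ⟨_, hf'.add hg', fun x => by rw [hf, hg, Complexification.ofReal_add]⟩
  | mul _ _ h₁ h₂ =>
    obtain ⟨f', hf', hf⟩ := h₁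
    obtain ⟨g', hg', hg⟩ := h₂
    exact ⟨_, hf'.mul hg', fun x => by rw [hf, hg, Complexification.ofReal_mul]⟩

/-- A map into a power of `B` with polynomial components is analytic: over `ℝ`, the components
extend to the complexification, and no condition links them. -/
theorem isKAnalyticOn_of_isPolyMap [IsTopologicalRing B] [ContinuousSMul K B]
    {F : Type*} [AddCommGroup F] [Module K F] [TopologicalSpace F]
    {ι : Type*} (Φ : F ≃L[K] (ι → B)) {f : E → F} (hf : ∀ i, IsPolyMap K fun x => Φ (f x) i)
    (U : Set E) : IsKAnalyticOn K f U := by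
  refine ⟨fun _ => isCkOn_of_isPolyMap Φ hf ⊤ U, fun _ => ?_⟩
  choose g hg hgf using fun i => (hf i).exists_complexification
  let Ψ : Complexification K F ≃L[ℂ] (ι → Complexification K B) :=
    (Complexification.congr Φ).trans (Complexification.piEquiv ι)
  refine ⟨Set.univ, fun z => Ψ.symm fun i => g i z, isOpen_univ, fun _ _ => trivial,
    fun x _ => ?_, isCkOn_of_isPolyMap Ψ (fun i => by simpa using hg i) ⊤ _⟩
  rw [ContinuousLinearEquiv.symm_apply_eq]
  funext i
  rw [hgf]
  exact Prod.ext rfl (congrFun (map_zero Φ).symm i)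

theorem isClassOn_of_isPolyMap [IsTopologicalRing B] [ContinuousSMul K B]
    {F : Type*} [AddCommGroup F] [Module K F] [TopologicalSpace F]
    {ι : Type*} (Φ : F ≃L[K] (ι → B)) {f : E → F} (hf : ∀ i, IsPolyMap K fun x => Φ (f x) i)
    (r : WithTop ℕ∞) (U : Set E) : IsClassOn K r f U :=
  ⟨fun s _ => isCkOn_of_isPolyMap Φ hf s U, fun _ => isKAnalyticOn_of_isPolyMap Φ hf U⟩

end Analytic

section TwoVariables

variable {K : Type*} [RCLike K] {B : Type*} [CommRing B] [Algebra K B] [TopologicalSpace B]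

/-- The expansion of a polynomial map of two scalars up to the mixed term of second order. -/
theorem IsPolyMap.exists_mixed_expansion [IsTopologicalRing B] [ContinuousSMul K B]
    {p : K × K → B} (hp : IsPolyMap K p) :
    ∃ (α β : K → B) (N : K × K → B), Continuous N ∧ Continuous α ∧ Continuous β ∧
      ∀ s t, p (s, t) = p 0 + s • α s + t • β t + (s * t) • N (s, t) := by
  induction hp with
  | const b => exact ⟨0, 0, 0, continuous_zero, continuous_zero, continuous_zero, by simp⟩
  | clm l =>
    refine ⟨fun _ => l (1, 0), fun _ => l (0, 1), 0, continuous_zero, continuous_const,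
      continuous_const, fun s t => ?_⟩
    have h : ((s, t) : K × K) = s • ((1, 0) : K × K) + t • ((0, 1) : K × K) := by simp
    simp only [map_zero]
    rw [h, map_add, map_smul, map_smul]
    simp
  | @add p q _ _ h₁ h₂ =>
    obtain ⟨α₁, β₁, N₁, hN₁, hα₁, hβ₁, h₁⟩ := h₁
    obtain ⟨α₂, β₂, N₂, hN₂, hα₂, hβ₂, h₂⟩ := h₂
    refine ⟨_, _, _, hN₁.add hN₂, hα₁.add hα₂, hβ₁.add hβ₂, fun s t => ?_⟩
    simp only [h₁ s t, h₂ s t, Pi.add_apply]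
    module
  | @mul p q _ _ h₁ h₂ =>
    obtain ⟨α₁, β₁, N₁, hN₁, hα₁, hβ₁, h₁⟩ := h₁
    obtain ⟨α₂, β₂, N₂, hN₂, hα₂, hβ₂, h₂⟩ := h₂
    refine ⟨fun s => p 0 * α₂ s + α₁ s * q 0 + s • (α₁ s * α₂ s),
      fun t => p 0 * β₂ t + β₁ t * q 0 + t • (β₁ t * β₂ t),
      fun x => p 0 * N₂ x + N₁ x * q 0 + α₁ x.1 * β₂ x.2 + β₁ x.2 * α₂ x.1 +
        x.1 • (α₁ x.1 * N₂ x + N₁ x * α₂ x.1) + x.2 • (β₁ x.2 * N₂ x + N₁ x * β₂ x.2) +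
        (x.1 * x.2) • (N₁ x * N₂ x), by fun_prop, by fun_prop, by fun_prop, fun s t => ?_⟩
    simp only [h₁ s t, h₂ s t]
    simp only [Algebra.smul_def, map_mul]
    ring

end TwoVariables

/-! ### The filtration of the convolution algebra -/

section Filtration

variable {K : Type*} [RCLike K] {H : Type*} [Ring H] [HopfAlgebra K H]
  {B : Type*} [CommRing B] [Algebra K B]

theorem ConvAlg.sum_apply {ι : Type*} (s : Finset ι) (u : ι → ConvAlg K H B) (a : H) :
    (∑ i ∈ s, u i) a = ∑ i ∈ s, u i a := by
  rw [WithConv.ofConv_sum, LinearMap.sum_apply]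

variable (B) in
/-- The linear maps on `H` that vanish in all degrees below `k`. -/
def vanishBelow (𝒜 : ℕ → Submodule K H) (k : ℕ) : Submodule K (ConvAlg K H B) where
  carrier := {φ | ∀ m < k, ∀ a ∈ 𝒜 m, φ a = 0}
  zero_mem' _ _ _ _ := rfl
  add_mem' {φ ψ} hφ hψ m hm a ha := by
    change φ a + ψ a = 0
    rw [hφ m hm a ha, hψ m hm a ha, add_zero]
  smul_mem' c φ hφ m hm a ha := by
    change c • φ a = 0
    rw [hφ m hm a ha, smul_zero]

variable {𝒜 : ℕ → Submodule K H} {φ ψ φ' : ConvAlg K H B} {k l : ℕ}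

theorem vanishBelow_antitone (h : k ≤ l) : vanishBelow B 𝒜 l ≤ vanishBelow B 𝒜 k :=
  fun _ hφ m hm => hφ m (hm.trans_le h)

theorem mem_vanishBelow_zero : φ ∈ vanishBelow B 𝒜 0 := fun _ hm => absurd hm (Nat.not_lt_zero _)

theorem mul_mem_vanishBelow (h𝒜 : IsConnectedHopfGrading 𝒜)
    (hφ : φ ∈ vanishBelow B 𝒜 k) (hψ : ψ ∈ vanishBelow B 𝒜 l) :
    φ * ψ ∈ vanishBelow B 𝒜 (k + l) := by
  intro n hn a ha
  rw [LinearMap.convMul_apply]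
  have h1 : ⨆ p ∈ Finset.HasAntidiagonal.antidiagonal n,
      LinearMap.range (TensorProduct.map (𝒜 p.1).subtype (𝒜 p.2).subtype) ≤
      LinearMap.ker (LinearMap.mul' K B ∘ₗ TensorProduct.map φ.ofConv ψ.ofConv) := by
    refine iSup₂_le fun p hp => ?_
    rw [LinearMap.range_le_ker_iff]
    refine TensorProduct.ext' fun x y => ?_
    have hp' := Finset.HasAntidiagonal.mem_antidiagonal.1 hp
    change φ (x : H) * ψ (y : H) = 0
    rcases lt_or_ge p.1 k with h | h
    · rw [hφ _ h _ x.2, zero_mul]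
    · rw [hψ p.2 (by omega) _ y.2, mul_zero]
  exact h1 (h𝒜.comul_mem ha)

theorem pow_mem_vanishBelow (h𝒜 : IsConnectedHopfGrading 𝒜)
    (hφ : φ ∈ vanishBelow B 𝒜 1) (n : ℕ) : φ ^ n ∈ vanishBelow B 𝒜 n := by
  induction n with
  | zero => exact mem_vanishBelow_zero
  | succ n ih => rw [pow_succ]; exact mul_mem_vanishBelow h𝒜 ih hφ

theorem IsConnectedHopfGrading.degree_zero (h𝒜 : IsConnectedHopfGrading 𝒜) :
    𝒜 0 = Submodule.span K {1} := by
  have : Nontrivial H := by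
    by_contra h
    rw [not_nontrivial_iff_subsingleton] at h
    have := h𝒜.connected
    rw [Module.finrank_zero_of_subsingleton] at this
    exact zero_ne_one this
  refine le_antisymm (fun a ha => ?_) ?_
  · have h0 : (⟨1, h𝒜.one_mem⟩ : 𝒜 0) ≠ 0 := fun h => one_ne_zero (congrArg Subtype.val h)
    obtain ⟨c, hc⟩ := exists_smul_eq_of_finrank_eq_one h𝒜.connected h0 ⟨a, ha⟩
    exact Submodule.mem_span_singleton.2 ⟨c, congrArg Subtype.val hc⟩
  · rw [Submodule.span_singleton_le_iff_mem]
    exact h𝒜.one_mem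

theorem mem_vanishBelow_one (h𝒜 : IsConnectedHopfGrading 𝒜) : φ ∈ vanishBelow B 𝒜 1 ↔ φ 1 = 0 := by
  refine ⟨fun h => h 0 one_pos 1 h𝒜.one_mem, fun h m hm a ha => ?_⟩
  obtain rfl : m = 0 := by omega
  rw [h𝒜.degree_zero] at ha
  obtain ⟨c, rfl⟩ := Submodule.mem_span_singleton.1 ha
  rw [map_smul, h, smul_zero]

/-- The filtration is exhausted pointwise: the value at `a` only sees finitely many steps. -/
theorem exists_forall_vanishBelow_apply (h𝒜 : IsConnectedHopfGrading 𝒜)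
    (a : H) :
    ∃ N, ∀ φ ∈ vanishBelow B 𝒜 N, φ a = 0 := by
  have ha : a ∈ ⨆ n, 𝒜 n := by rw [h𝒜.isInternal.submodule_iSup_eq_top]; trivial
  induction ha using Submodule.iSup_induction' with
  | mem n a ha => exact ⟨n + 1, fun φ hφ => hφ n n.lt_succ_self a ha⟩
  | zero => exact ⟨0, fun φ _ => map_zero _⟩
  | add a b _ _ iha ihb =>
    obtain ⟨m, hm⟩ := iha
    obtain ⟨n, hn⟩ := ihb
    refine ⟨max m n, fun φ hφ => ?_⟩
    rw [map_add, hm φ (vanishBelow_antitone (le_max_left m n) hφ),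
      hn φ (vanishBelow_antitone (le_max_right m n) hφ), add_zero]

theorem eq_of_forall_sub_mem_vanishBelow (h𝒜 : IsConnectedHopfGrading 𝒜)
    (h : ∀ N, φ - ψ ∈ vanishBelow B 𝒜 N) : φ = ψ := by
  refine WithConv.ext (LinearMap.ext fun a => ?_)
  obtain ⟨N, hN⟩ := exists_forall_vanishBelow_apply (B := B) h𝒜 a
  exact sub_eq_zero.1 (hN _ (h N))

/-- If `φ` and `φ'` vanish in degree `0` and agree below degree `k`, then their powers agree even
to higher order. -/
theorem pow_succ_sub_pow_succ_mem (h𝒜 : IsConnectedHopfGrading 𝒜)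
    (hφ : φ ∈ vanishBelow B 𝒜 1) (hφ' : φ' ∈ vanishBelow B 𝒜 1)
    (h : φ - φ' ∈ vanishBelow B 𝒜 k) (n : ℕ) :
    φ ^ (n + 1) - φ' ^ (n + 1) ∈ vanishBelow B 𝒜 (k + n) := by
  induction n with
  | zero => simpa using h
  | succ n ih =>
    have h1 : φ ^ (n + 1 + 1) - φ' ^ (n + 1 + 1) =
        (φ ^ (n + 1) - φ' ^ (n + 1)) * φ + φ' ^ (n + 1) * (φ - φ') := by
      rw [pow_succ φ (n + 1), pow_succ φ' (n + 1)]
      noncomm_ring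
    rw [h1]
    refine add_mem (by simpa only [add_assoc] using mul_mem_vanishBelow h𝒜 ih hφ) ?_
    rw [add_comm k]
    exact mul_mem_vanishBelow h𝒜 (pow_mem_vanishBelow h𝒜 hφ' _) h

end Filtration

/-! ### Exponential and logarithm of the convolution algebra -/

section Exp

variable {K : Type*} [RCLike K] {H : Type*} [Ring H] [HopfAlgebra K H]
  {B : Type*} [CommRing B] [Algebra K B] [TopologicalSpace B]

namespace ConvAlg

/-- Convergence in the convolution algebra is pointwise convergence. -/
theorem isInducing_coe : Topology.IsInducing fun (φ : ConvAlg K H B) (a : H) => φ a := ⟨rfl⟩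

variable (K H B) in
/-- Evaluation at `a`, as a continuous linear form. -/
def eval (a : H) : ConvAlg K H B →L[K] B where
  toFun φ := φ a
  map_add' _ _ := rfl
  map_smul' _ _ := rfl
  cont := (continuous_apply a).comp isInducing_coe.continuous

instance [T2Space B] : T2Space (ConvAlg K H B) :=
  T2Space.of_injective_continuous (f := fun (φ : ConvAlg K H B) (a : H) => φ a)
    (fun _ _ h => WithConv.ext (LinearMap.ext (congrFun h))) isInducing_coe.continuous

theorem tendsto_iff {α : Type*} {l : Filter α} {f : α → ConvAlg K H B} {φ : ConvAlg K H B} :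
    Tendsto f l (𝓝 φ) ↔ ∀ a, Tendsto (fun x => f x a) l (𝓝 (φ a)) := by
  rw [isInducing_coe.tendsto_nhds_iff, tendsto_pi_nhds]
  rfl

theorem hasSum_iff {u : ℕ → ConvAlg K H B} {φ : ConvAlg K H B} :
    HasSum u φ ↔ ∀ a, HasSum (fun n => u n a) (φ a) := by
  simp only [HasSum, tendsto_iff, sum_apply]

end ConvAlg

variable {𝒜 : ℕ → Submodule K H} {φ ψ φ' : ConvAlg K H B} {k l : ℕ}

/-- The sum of the exponential series of the convolution algebra. -/
def convExp (φ : ConvAlg K H B) : ConvAlg K H B := ∑' n : ℕ, ((n.factorial : K)⁻¹) • φ ^ n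

/-- Successive approximations to the solution `φ` of `convExp φ = ψ`. -/
def logApprox (ψ : ConvAlg K H B) : ℕ → ConvAlg K H B
  | 0 => 0
  | k + 1 => logApprox ψ k + (ψ - convExp (logApprox ψ k))

/-- The logarithm of the convolution algebra, as the limit of the successive approximations. -/
def convLog (ψ : ConvAlg K H B) : ConvAlg K H B := ∑' k, (ψ - convExp (logApprox ψ k))

theorem convExp_zero : convExp (0 : ConvAlg K H B) = 1 := by
  refine (tsum_eq_single 0 fun n hn => ?_).trans (by simp)
  rw [zero_pow hn, smul_zero]

/-- A series whose `n`-th term vanishes below degree `n` converges, since its evaluations are finite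
sums; the limit agrees with the `N`-th partial sum below degree `N`. -/
theorem exists_hasSum_of_mem_vanishBelow (h𝒜 : IsConnectedHopfGrading 𝒜) {u : ℕ → ConvAlg K H B}
    (hu : ∀ n, u n ∈ vanishBelow B 𝒜 n) :
    ∃ S, HasSum u S ∧ ∀ N, S - ∑ n ∈ Finset.range N, u n ∈ vanishBelow B 𝒜 N := by
  choose N hN using exists_forall_vanishBelow_apply (B := B) h𝒜
  have hs (a : H) {M : ℕ} (hM : ∀ n, M ≤ n → u n a = 0) :
      ∑ᶠ n, u n a = ∑ n ∈ Finset.range M, u n a := by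
    refine finsum_eq_sum_of_support_subset _ fun n hn => ?_
    rw [Finset.coe_range, Set.mem_Iio]
    by_contra h
    exact hn (hM n (not_lt.1 h))
  have hv (a : H) (n : ℕ) (hn : N a ≤ n) : u n a = 0 := hN a _ (vanishBelow_antitone hn (hu n))
  have hfin (a : H) : (Function.support fun n => u n a).Finite := by
    refine (Finset.range (N a)).finite_toSet.subset fun n hn => ?_
    rw [Finset.coe_range, Set.mem_Iio]
    by_contra h
    exact hn (hv a n (not_lt.1 h))
  let S : ConvAlg K H B := WithConv.toConv
    { toFun := fun a => ∑ᶠ n, u n a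
      map_add' := fun a b => by
        simp only [map_add]
        exact finsum_add_distrib (hfin a) (hfin b)
      map_smul' := fun c a => by
        simp only [map_smul, RingHom.id_apply]
        exact (smul_finsum' c (hfin a)).symm }
  refine ⟨S, ConvAlg.hasSum_iff.2 fun a => ?_, fun M m hm a ha => ?_⟩
  · change HasSum _ (∑ᶠ n, u n a)
    rw [hs a (hv a)]
    exact hasSum_sum_of_ne_finset_zero fun n hn => hv a n (by simpa using hn)
  · change (∑ᶠ n, u n a) - (∑ n ∈ Finset.range M, u n) a = 0
    rw [hs a fun n hn => hu n m (hm.trans_le hn) a ha, ConvAlg.sum_apply, sub_self]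

theorem hasSum_convExp (h𝒜 : IsConnectedHopfGrading 𝒜)
    (hφ : φ ∈ vanishBelow B 𝒜 1) :
    HasSum (fun n : ℕ => ((n.factorial : K)⁻¹) • φ ^ n) (convExp φ) := by
  obtain ⟨S, hS, -⟩ := exists_hasSum_of_mem_vanishBelow h𝒜
    fun n => (vanishBelow B 𝒜 n).smul_mem ((n.factorial : K)⁻¹) (pow_mem_vanishBelow h𝒜 hφ n)
  exact hS.summable.hasSum

variable [T2Space B]

theorem convExp_sub_sum_mem (h𝒜 : IsConnectedHopfGrading 𝒜)
    (hφ : φ ∈ vanishBelow B 𝒜 1) (N : ℕ) :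
    convExp φ - ∑ n ∈ Finset.range N, ((n.factorial : K)⁻¹) • φ ^ n ∈ vanishBelow B 𝒜 N := by
  obtain ⟨S, hS, hN⟩ := exists_hasSum_of_mem_vanishBelow h𝒜
    fun n => (vanishBelow B 𝒜 n).smul_mem ((n.factorial : K)⁻¹) (pow_mem_vanishBelow h𝒜 hφ n)
  rw [convExp, hS.tsum_eq]
  exact hN N

theorem convExp_sub_one_mem (h𝒜 : IsConnectedHopfGrading 𝒜)
    (hφ : φ ∈ vanishBelow B 𝒜 1) :
    convExp φ - 1 ∈ vanishBelow B 𝒜 1 := by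
  simpa using convExp_sub_sum_mem h𝒜 hφ 1

/-- If `φ` and `φ'` agree below degree `k`, then in degree `k` their exponentials differ exactly by
`φ - φ'`: differences of higher powers live in higher degrees. -/
theorem convExp_sub_convExp_mem (h𝒜 : IsConnectedHopfGrading 𝒜)
    (hφ : φ ∈ vanishBelow B 𝒜 1) (hφ' : φ' ∈ vanishBelow B 𝒜 1)
    (h : φ - φ' ∈ vanishBelow B 𝒜 k) :
    convExp φ - convExp φ' - (φ - φ') ∈ vanishBelow B 𝒜 (k + 1) := by
  have h1 := vanishBelow_antitone k.succ.le_succ (convExp_sub_sum_mem h𝒜 hφ (k + 2))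
  have h2 := vanishBelow_antitone k.succ.le_succ (convExp_sub_sum_mem h𝒜 hφ' (k + 2))
  have h3 : ∑ n ∈ Finset.range k, (((n + 2).factorial : K)⁻¹) • (φ ^ (n + 2) - φ' ^ (n + 2)) ∈
      vanishBelow B 𝒜 (k + 1) := by
    refine sum_mem fun n _ => Submodule.smul_mem _ _ ?_
    exact vanishBelow_antitone (by omega) (pow_succ_sub_pow_succ_mem h𝒜 hφ hφ' h (n + 1))
  rw [Finset.sum_range_succ', Finset.sum_range_succ'] at h1 h2
  have h4 := add_mem (sub_mem h1 h2) h3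
  simp only [smul_sub, Finset.sum_sub_distrib] at h4
  convert h4 using 1
  simp
  abel

theorem convExp_injective (h𝒜 : IsConnectedHopfGrading 𝒜)
    (hφ : φ ∈ vanishBelow B 𝒜 1) (hφ' : φ' ∈ vanishBelow B 𝒜 1)
    (h : convExp φ = convExp φ') : φ = φ' := by
  refine eq_of_forall_sub_mem_vanishBelow h𝒜 fun N => ?_
  induction N with
  | zero => exact mem_vanishBelow_zero
  | succ N ih =>
    have h1 := convExp_sub_convExp_mem h𝒜 hφ hφ' ih
    rw [h, sub_self, zero_sub] at h1
    simpa using neg_mem h1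

theorem logApprox_mem (h𝒜 : IsConnectedHopfGrading 𝒜)
    (hψ : ψ - 1 ∈ vanishBelow B 𝒜 1) (k : ℕ) :
    logApprox ψ k ∈ vanishBelow B 𝒜 1 := by
  induction k with
  | zero => exact zero_mem _
  | succ k ih =>
    refine add_mem ih ?_
    have h1 := sub_mem hψ (convExp_sub_one_mem h𝒜 ih)
    rwa [sub_sub_sub_cancel_right] at h1

theorem sub_convExp_logApprox_mem (h𝒜 : IsConnectedHopfGrading 𝒜)
    (hψ : ψ - 1 ∈ vanishBelow B 𝒜 1) (k : ℕ) :
    ψ - convExp (logApprox ψ k) ∈ vanishBelow B 𝒜 (k + 1) := by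
  induction k with
  | zero => simpa [logApprox, convExp_zero] using hψ
  | succ k ih =>
    have h1 := convExp_sub_convExp_mem (φ := logApprox ψ (k + 1)) (φ' := logApprox ψ k)
      (k := k + 1) h𝒜 (logApprox_mem h𝒜 hψ (k + 1)) (logApprox_mem h𝒜 hψ k)
      (by rw [logApprox, add_sub_cancel_left]; exact ih)
    have h2 := neg_mem h1
    convert h2 using 1
    simp only [logApprox]
    abel

theorem convLog_sub_logApprox_mem (h𝒜 : IsConnectedHopfGrading 𝒜)
    (hψ : ψ - 1 ∈ vanishBelow B 𝒜 1) (N : ℕ) :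
    convLog ψ - logApprox ψ N ∈ vanishBelow B 𝒜 N := by
  obtain ⟨S, hS, hN⟩ := exists_hasSum_of_mem_vanishBelow h𝒜
    fun n => vanishBelow_antitone n.le_succ (sub_convExp_logApprox_mem h𝒜 hψ n)
  have h1 (N : ℕ) : ∑ n ∈ Finset.range N, (ψ - convExp (logApprox ψ n)) = logApprox ψ N := by
    induction N with
    | zero => rfl
    | succ N ih => rw [Finset.sum_range_succ, ih, logApprox]
  rw [convLog, hS.tsum_eq, ← h1]
  exact hN N

theorem convLog_mem (h𝒜 : IsConnectedHopfGrading 𝒜)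
    (hψ : ψ - 1 ∈ vanishBelow B 𝒜 1) : convLog ψ ∈ vanishBelow B 𝒜 1 := by
  have h1 := add_mem (convLog_sub_logApprox_mem h𝒜 hψ 1) (logApprox_mem h𝒜 hψ 1)
  rwa [sub_add_cancel] at h1

theorem convExp_convLog (h𝒜 : IsConnectedHopfGrading 𝒜)
    (hψ : ψ - 1 ∈ vanishBelow B 𝒜 1) : convExp (convLog ψ) = ψ := by
  refine eq_of_forall_sub_mem_vanishBelow h𝒜 fun N => ?_
  have h0 := convLog_sub_logApprox_mem h𝒜 hψ N
  have h1 := vanishBelow_antitone N.le_succ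
    (convExp_sub_convExp_mem h𝒜 (convLog_mem h𝒜 hψ) (logApprox_mem h𝒜 hψ N) h0)
  have h2 := vanishBelow_antitone N.le_succ (sub_convExp_logApprox_mem h𝒜 hψ N)
  have h3 := sub_mem (add_mem h1 h0) h2
  rwa [sub_add_cancel, sub_sub_sub_cancel_right] at h3

theorem convLog_convExp (h𝒜 : IsConnectedHopfGrading 𝒜)
    (hφ : φ ∈ vanishBelow B 𝒜 1) : convLog (convExp φ) = φ :=
  convExp_injective h𝒜 (convLog_mem h𝒜 (convExp_sub_one_mem h𝒜 hφ)) hφ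
    (convExp_convLog h𝒜 (convExp_sub_one_mem h𝒜 hφ))

/-- The functional equation of the exponential map on a line, checked on partial sums: by the
binomial theorem the terms of total degree below `N` match, and the others lie in the filtration. -/
theorem convExp_add_smul (h𝒜 : IsConnectedHopfGrading 𝒜)
    (hφ : φ ∈ vanishBelow B 𝒜 1) (s t : K) :
    convExp ((s + t) • φ) = convExp (s • φ) * convExp (t • φ) := by
  refine eq_of_forall_sub_mem_vanishBelow h𝒜 fun N => ?_
  let e (n : ℕ) : ConvAlg K H B := ((n.factorial : K)⁻¹) • φ ^ n
  have he (n : ℕ) : e n ∈ vanishBelow B 𝒜 n :=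
    Submodule.smul_mem _ _ (pow_mem_vanishBelow h𝒜 hφ n)
  have h1 (c : K) : convExp (c • φ) - ∑ n ∈ Finset.range N, c ^ n • e n ∈ vanishBelow B 𝒜 N := by
    simpa only [e, smul_pow, smul_comm _ (c ^ _)] using
      convExp_sub_sum_mem h𝒜 (Submodule.smul_mem _ c hφ) N
  have hee (i j : ℕ) : e i * e j = ((i + j).choose i : K) • e (i + j) := by
    simp only [e, smul_mul_smul_comm, ← pow_add, smul_smul]
    congr 1
    rw [Nat.cast_add_choose]
    have := Nat.cast_ne_zero (R := K).2 (i + j).factorial_ne_zero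
    field_simp
  have h2 : (∑ n ∈ Finset.range N, s ^ n • e n) * (∑ n ∈ Finset.range N, t ^ n • e n) -
      ∑ n ∈ Finset.range N, (s + t) ^ n • e n ∈ vanishBelow B 𝒜 N := by
    have h3 : ∑ n ∈ Finset.range N, (s + t) ^ n • e n =
        ∑ i ∈ Finset.range N, ∑ j ∈ Finset.range (N - i), (s ^ i • e i) * (t ^ j • e j) := by
      rw [← Finset.sum_range_diag_flip N fun i j => (s ^ i • e i) * (t ^ j • e j)]
      refine Finset.sum_congr rfl fun n _ => ?_
      rw [add_pow, Finset.sum_smul]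
      refine Finset.sum_congr rfl fun i hi => ?_
      have hi' : i + (n - i) = n := by have := Finset.mem_range.1 hi; omega
      rw [smul_mul_smul_comm, hee, hi', ← smul_smul]
    rw [h3, Finset.sum_mul_sum, ← Finset.sum_sub_distrib]
    refine sum_mem fun i hi => ?_
    have hi' := Finset.mem_range.1 hi
    rw [← Finset.sum_range_add_sum_Ico _ (Nat.sub_le N i), add_sub_cancel_left]
    refine sum_mem fun j hj => ?_
    have hj' := Finset.mem_Ico.1 hj
    rw [smul_mul_smul_comm]
    exact Submodule.smul_mem _ _ (vanishBelow_antitone (by omega)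
      (mul_mem_vanishBelow h𝒜 (he i) (he j)))
  have h4 : convExp (s • φ) * convExp (t • φ) -
      (∑ n ∈ Finset.range N, s ^ n • e n) * (∑ n ∈ Finset.range N, t ^ n • e n) ∈
      vanishBelow B 𝒜 N := by
    have h5 (x y x' y' : ConvAlg K H B) :
        x * y - x' * y' = (x - x') * y + x' * (y - y') := by noncomm_ring
    rw [h5]
    refine add_mem (mul_mem_vanishBelow (l := 0) h𝒜 (h1 s) mem_vanishBelow_zero) ?_
    simpa using mul_mem_vanishBelow (k := 0) h𝒜 mem_vanishBelow_zero (h1 t)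
  have h6 := sub_mem (sub_mem (h1 (s + t)) h2) h4
  convert h6 using 1
  abel

theorem convExp_natCast_smul (h𝒜 : IsConnectedHopfGrading 𝒜)
    (hφ : φ ∈ vanishBelow B 𝒜 1) (n : ℕ) :
    convExp ((n : K) • φ) = convExp φ ^ n := by
  induction n with
  | zero => simp [convExp_zero]
  | succ n ih => rw [Nat.cast_succ, convExp_add_smul h𝒜 hφ, ih, one_smul, pow_succ]

end Exp

/-! ### Polynomial maps into the convolution algebra -/

section PolyConv

variable {K : Type*} [RCLike K] {H : Type*} [Ring H] [HopfAlgebra K H]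
  {B : Type*} [CommRing B] [Algebra K B] [TopologicalSpace B]
  {E : Type*} [AddCommGroup E] [Module K E] [TopologicalSpace E]

/-- A map into `Hom_K (H, B)` all of whose evaluations are polynomial maps. -/
def IsPointwisePoly (f : E → ConvAlg K H B) : Prop := ∀ a : H, IsPolyMap K fun x => f x a

namespace IsPointwisePoly

variable {f g : E → ConvAlg K H B}

theorem clm (l : E →L[K] ConvAlg K H B) : IsPointwisePoly fun x => l x :=
  fun a => IsPolyMap.clm ((ConvAlg.eval K H B a).comp l)

theorem const (φ : ConvAlg K H B) : IsPointwisePoly fun _ : E => φ := fun _ => IsPolyMap.const _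

theorem add (hf : IsPointwisePoly f) (hg : IsPointwisePoly g) :
    IsPointwisePoly fun x => f x + g x := fun a => (hf a).add (hg a)

theorem sub (hf : IsPointwisePoly f) (hg : IsPointwisePoly g) :
    IsPointwisePoly fun x => f x - g x := fun a => (hf a).sub (hg a)

theorem smul (c : K) (hf : IsPointwisePoly f) : IsPointwisePoly fun x => c • f x :=
  fun a => (hf a).smul c

theorem mul (hf : IsPointwisePoly f) (hg : IsPointwisePoly g) :
    IsPointwisePoly fun x => f x * g x := by
  intro a
  simp only [(Coalgebra.Repr.arbitrary K a).convMul_apply]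
  exact IsPolyMap.sum fun i _ => (hf _).mul (hg _)

theorem pow (hf : IsPointwisePoly f) (n : ℕ) : IsPointwisePoly fun x => f x ^ n := by
  induction n with
  | zero => simpa using const 1
  | succ n ih => simpa only [pow_succ] using ih.mul hf

theorem comp_clm {X : Type*} [AddCommGroup X] [Module K X] [TopologicalSpace X]
    (hf : IsPointwisePoly f) (T : X →L[K] E) : IsPointwisePoly fun x => f (T x) :=
  fun a => (hf a).comp_clm T

theorem continuous [IsTopologicalRing B] (hf : IsPointwisePoly f) : Continuous f :=
  ConvAlg.isInducing_coe.continuous_iff.2 (continuous_pi fun a => (hf a).continuous)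

variable {𝒜 : ℕ → Submodule K H}

/-- A map that agrees with pointwise polynomial maps below any given degree is itself pointwise
polynomial. -/
theorem of_sub_mem (h𝒜 : IsConnectedHopfGrading 𝒜)
    (F : ℕ → E → ConvAlg K H B) (hF : ∀ N, IsPointwisePoly (F N))
    (h : ∀ N x, f x - F N x ∈ vanishBelow B 𝒜 N) : IsPointwisePoly f := by
  intro a
  obtain ⟨N, hN⟩ := exists_forall_vanishBelow_apply (B := B) h𝒜 a
  convert hF N a using 2 with x
  exact sub_eq_zero.1 (hN _ (h N x))

variable [T2Space B]

theorem convExp (h𝒜 : IsConnectedHopfGrading 𝒜)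
    (hf : IsPointwisePoly f) (h : ∀ x, f x ∈ vanishBelow B 𝒜 1) :
    IsPointwisePoly fun x => convExp (f x) := by
  refine of_sub_mem h𝒜 _ (fun N a => ?_) fun N x => convExp_sub_sum_mem h𝒜 (h x) N
  simp only [ConvAlg.sum_apply]
  exact IsPolyMap.sum fun n _ => ((hf.pow n).smul _) a

theorem convLog (h𝒜 : IsConnectedHopfGrading 𝒜)
    (hf : IsPointwisePoly f) (h : ∀ x, f x - 1 ∈ vanishBelow B 𝒜 1) :
    IsPointwisePoly fun x => convLog (f x) := by
  refine of_sub_mem h𝒜 _ (fun N => ?_) fun N x => convLog_sub_logApprox_mem h𝒜 (h x) N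
  induction N with
  | zero => exact const 0
  | succ N ih => exact ih.add (hf.sub (ih.convExp h𝒜 fun x => logApprox_mem h𝒜 (h x) N))

end IsPointwisePoly

end PolyConv

/-! ### Coordinates on spaces of linear maps -/

section Coordinates

variable {K : Type*} [RCLike K] {H : Type*} [Ring H] [HopfAlgebra K H]
  {B : Type*} [CommRing B] [Algebra K B] [TopologicalSpace B]

theorem ConvAlg.continuous_iff {X : Type*} [TopologicalSpace X] {f : X → ConvAlg K H B} :
    Continuous f ↔ ∀ a, Continuous fun x => f x a := by
  rw [ConvAlg.isInducing_coe.continuous_iff, continuous_pi_iff]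
  rfl

/-- A space which embeds onto the space of all linear maps `H → B` vanishing on a subspace `W` is
topologically isomorphic to a power of `B`: a linear map is determined by its values on
representatives of a basis of `H ⧸ W`, and these values are arbitrary. -/
theorem exists_equiv_pi_of_range_eq.{u} {K : Type*} [RCLike K] {H : Type u} [Ring H]
    [HopfAlgebra K H] {B : Type*} [CommRing B] [Algebra K B] [TopologicalSpace B]
    [IsTopologicalRing B] [ContinuousSMul K B]
    {E : Type*} [AddCommGroup E] [Module K E] [TopologicalSpace E] (l : E →L[K] ConvAlg K H B)
    (hl : Topology.IsEmbedding l) (W : Submodule K H)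
    (hW : ∀ φ : ConvAlg K H B, (∃ x, l x = φ) ↔ ∀ w ∈ W, φ w = 0) :
    ∃ (ι : Type u) (h : ι → H) (Φ : E ≃L[K] (ι → B)), (∀ x i, Φ x i = l x (h i)) ∧
      Cardinal.mk ι ≤ Module.rank K H := by
  let b := Module.Basis.ofVectorSpace K (H ⧸ W)
  choose h hh using fun i => W.mkQ_surjective (b i)
  let g (f : Module.Basis.ofVectorSpaceIndex K (H ⧸ W) → B) : ConvAlg K H B :=
    WithConv.toConv ((b.constr K f) ∘ₗ W.mkQ)
  have hg (f) (a : H) : g f a = b.constr K f (W.mkQ a) := rfl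
  have hgW (f) : ∃ x, l x = g f := (hW _).2 fun w hw => by
    rw [hg, Submodule.mkQ_apply, (Submodule.Quotient.mk_eq_zero W).2 hw, map_zero]
  choose r hr using hgW
  have hgh (f i) : g f (h i) = f i := by rw [hg, hh, b.constr_basis]
  have hinj {x y : E} (hxy : ∀ i, l x (h i) = l y (h i)) : x = y := by
    have h0 : ∀ w ∈ W, (l (x - y)) w = 0 := (hW _).1 ⟨x - y, rfl⟩
    have h1 : W.liftQ (l (x - y)).ofConv h0 = 0 := b.ext fun i => by
      rw [← hh]
      change l (x - y) (h i) = 0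
      rw [map_sub]
      exact sub_eq_zero.2 (hxy i)
    refine sub_eq_zero.1 (hl.injective ?_)
    rw [map_zero]
    refine WithConv.ext (LinearMap.ext fun a => ?_)
    exact LinearMap.congr_fun h1 (W.mkQ a)
  refine ⟨_, h,
    { toFun := fun x i => l x (h i)
      invFun := r
      left_inv := fun x => hinj fun i => by rw [hr, hgh]
      right_inv := fun f => funext fun i =>
        (congrArg (fun φ : ConvAlg K H B => φ (h i)) (hr f)).trans (hgh f i)
      map_add' := fun x y => funext fun i => by rw [map_add]; rfl
      map_smul' := fun c x => funext fun i => by rw [map_smul]; rfl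
      continuous_toFun := continuous_pi fun i => (ConvAlg.eval K H B (h i)).continuous.comp
        l.continuous
      continuous_invFun := ?_ }, fun _ _ => rfl, ?_⟩
  · refine hl.continuous_iff.2 (ConvAlg.continuous_iff.2 fun a => ?_)
    simp only [Function.comp_apply, hr, hg, Module.Basis.constr_apply]
    exact continuous_finsetSum _ fun i _ => (continuous_apply i).const_smul _
  · exact b.mk_eq_rank''.le.trans (rank_quotient_le W)

theorem ConvAlg.exists_equiv_pi.{u} (K : Type*) [RCLike K] (H : Type u) [Ring H] [HopfAlgebra K H]
    (B : Type*) [CommRing B] [Algebra K B] [TopologicalSpace B]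
    [IsTopologicalRing B] [ContinuousSMul K B] :
    ∃ (ι : Type u) (h : ι → H) (Φ : ConvAlg K H B ≃L[K] (ι → B)),
    ∀ x i, Φ x i = x (h i) := by
  obtain ⟨ι, h, Φ, hΦ, -⟩ := exists_equiv_pi_of_range_eq (ContinuousLinearMap.id K (ConvAlg K H B))
    Topology.IsEmbedding.id ⊥ fun φ =>
      ⟨fun _ w hw => by rw [(Submodule.mem_bot K).1 hw, map_zero], fun _ => ⟨φ, rfl⟩⟩
  exact ⟨ι, h, Φ, hΦ⟩

end Coordinates

/-! ### Characters and infinitesimal characters -/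

section Characters

open Coalgebra

variable {K : Type*} [RCLike K] {H : Type*} [Ring H] [HopfAlgebra K H]
  {B : Type*} [CommRing B] [Algebra K B]

theorem apply_one_of_mem_infChar {φ : ConvAlg K H B} (hφ : φ ∈ InfChar K H B) : φ 1 = 0 := by
  simpa using hφ 1 1

/-- Infinitesimal characters are the linear maps that vanish at `1` and on the square of the
augmentation ideal. -/
theorem mem_infChar_iff_forall_span {φ : ConvAlg K H B} : φ ∈ InfChar K H B ↔
    ∀ w ∈ Submodule.span K ({1} ∪ {w : H | ∃ a b : H, counit (R := K) a = 0 ∧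
      counit (R := K) b = 0 ∧ w = a * b}), φ w = 0 := by
  constructor
  · intro hφ w hw
    induction hw using Submodule.span_induction with
    | mem w hw =>
      rcases hw with hw | ⟨a, b, ha, hb, rfl⟩
      · rw [Set.mem_singleton_iff.1 hw, apply_one_of_mem_infChar hφ]
      · rw [hφ, ha, hb, zero_smul, zero_smul, add_zero]
    | zero => exact map_zero _
    | add x y _ _ hx hy => rw [map_add, hx, hy, add_zero]
    | smul c x _ hx => rw [map_smul, hx, smul_zero]
  · intro hφ a b
    have h1 : φ 1 = 0 := hφ 1 (Submodule.subset_span (Or.inl rfl))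
    have h2 : φ ((a - algebraMap K H (counit a)) * (b - algebraMap K H (counit b))) = 0 :=
      hφ _ (Submodule.subset_span (Or.inr ⟨_, _, by simp, by simp, rfl⟩))
    simp only [sub_mul, mul_sub, map_sub, Algebra.algebraMap_eq_smul_one, smul_mul_assoc, one_mul,
      mul_smul_comm, mul_one, map_smul, h1, smul_zero, sub_zero] at h2
    rw [sub_sub, sub_eq_zero] at h2
    rw [h2, add_comm]

/-- A product rule is passed on by convolution with an infinitesimal character: if `α` is expanded
on products into `∑ i, β i ⊗ γ i`, then `φ` acts on the expansion as a derivation. -/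
theorem InfChar.mul_apply_mul_of_expansion {φ : ConvAlg K H B} (hφ : φ ∈ InfChar K H B) {ι : Type*}
    (s : Finset ι) {α : ConvAlg K H B} {β γ : ι → ConvAlg K H B}
    (hα : ∀ a b, α (a * b) = ∑ i ∈ s, β i a * γ i b) (a b : H) :
    (φ * α) (a * b) = ∑ i ∈ s, ((φ * β i) a * γ i b + β i a * (φ * γ i) b) := by
  have h1 (χ : ConvAlg K H B) (c : H) :
      ∑ i ∈ (ℛ K c).index, counit (R := K) ((ℛ K c).left i) • χ ((ℛ K c).right i) = χ c := by
    conv_rhs => rw [← sum_counit_smul (ℛ K c)]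
    simp
  have key (i : ι) : (φ * β i) a * γ i b + β i a * (φ * γ i) b =
      ∑ x ∈ (ℛ K a).index, ∑ y ∈ (ℛ K b).index,
        φ ((ℛ K a).left x * (ℛ K b).left y) *
          (β i ((ℛ K a).right x) * γ i ((ℛ K b).right y)) := by
    rw [(ℛ K a).convMul_apply, (ℛ K b).convMul_apply]
    conv_lhs => rw [← h1 (γ i) b, ← h1 (β i) a]
    rw [Finset.sum_mul_sum, Finset.sum_mul_sum, ← Finset.sum_add_distrib]
    refine Finset.sum_congr rfl fun x _ => ?_
    rw [← Finset.sum_add_distrib]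
    refine Finset.sum_congr rfl fun y _ => ?_
    rw [hφ]
    simp only [Algebra.smul_def]
    ring
  rw [((ℛ K a).mul (ℛ K b)).convMul_apply]
  change ∑ x ∈ (ℛ K a).index ×ˢ (ℛ K b).index,
    φ ((ℛ K a).left x.1 * (ℛ K b).left x.2) * α ((ℛ K a).right x.1 * (ℛ K b).right x.2) = _
  simp only [key, hα, Finset.mul_sum, Finset.sum_product]
  exact (Finset.sum_congr rfl fun x _ => Finset.sum_comm).trans Finset.sum_comm

/-- The divided powers of an infinitesimal character satisfy the Leibniz rule. -/
theorem InfChar.dividedPow_apply_mul {φ : ConvAlg K H B} (hφ : φ ∈ InfChar K H B) (n : ℕ)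
    (a b : H) : (((n.factorial : K)⁻¹) • φ ^ n) (a * b) =
      ∑ p ∈ Finset.HasAntidiagonal.antidiagonal n, (((p.1.factorial : K)⁻¹) • φ ^ p.1) a *
        (((p.2.factorial : K)⁻¹) • φ ^ p.2) b := by
  let e (n : ℕ) : ConvAlg K H B := ((n.factorial : K)⁻¹) • φ ^ n
  have hφe (n : ℕ) : φ * e n = ((n + 1 : ℕ) : K) • e (n + 1) := by
    simp only [e, mul_smul_comm, ← pow_succ', smul_smul]
    congr 1
    have h1 := Nat.cast_ne_zero (R := K).2 n.factorial_ne_zero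
    have h2 := Nat.cast_ne_zero (R := K).2 n.succ_ne_zero
    rw [Nat.factorial_succ, Nat.cast_mul, Nat.succ_eq_add_one] at *
    field_simp
  change e n (a * b) = ∑ p ∈ Finset.HasAntidiagonal.antidiagonal n, e p.1 a * e p.2 b
  induction n generalizing a b with
  | zero =>
    have h (a : H) : e 0 a = algebraMap K B (counit a) := by
      simp [e]
    simp [h]
  | succ n ih =>
    have h1 := InfChar.mul_apply_mul_of_expansion hφ (Finset.HasAntidiagonal.antidiagonal n)
      (β := fun p => e p.1) (γ := fun p => e p.2) ih a b
    simp only [hφe] at h1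
    have h2 : ((n + 1 : ℕ) : K) •
        ∑ p ∈ Finset.HasAntidiagonal.antidiagonal (n + 1), e p.1 a * e p.2 b =
        ∑ p ∈ Finset.HasAntidiagonal.antidiagonal (n + 1), (p.1 : K) • (e p.1 a * e p.2 b) +
          ∑ p ∈ Finset.HasAntidiagonal.antidiagonal (n + 1), (p.2 : K) • (e p.1 a * e p.2 b) := by
      rw [← Finset.sum_add_distrib, Finset.smul_sum]
      refine Finset.sum_congr rfl fun p hp => ?_
      rw [← add_smul, ← Nat.cast_add, Finset.HasAntidiagonal.mem_antidiagonal.1 hp]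
    rw [Finset.Nat.sum_antidiagonal_succ (f := fun p => (p.1 : K) • (e p.1 a * e p.2 b)),
      Finset.Nat.sum_antidiagonal_succ' (f := fun p => (p.2 : K) • (e p.1 a * e p.2 b))] at h2
    simp only [Nat.cast_zero, zero_smul, zero_add] at h2
    have h3 : ((n + 1 : ℕ) : K) • e (n + 1) (a * b) =
        ((n + 1 : ℕ) : K) •
          ∑ p ∈ Finset.HasAntidiagonal.antidiagonal (n + 1), e p.1 a * e p.2 b := by
      rw [h2, ← Finset.sum_add_distrib]
      refine h1.trans (Finset.sum_congr rfl fun p _ => ?_)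
      change (((p.1 + 1 : ℕ) : K) • e (p.1 + 1) a) * e p.2 b +
        e p.1 a * (((p.2 + 1 : ℕ) : K) • e (p.2 + 1) b) = _
      rw [smul_mul_assoc, mul_smul_comm]
    exact smul_right_injective B (Nat.cast_ne_zero (R := K).2 n.succ_ne_zero) h3

/-- A polynomial over a `K`-algebra is determined by its values at the natural numbers. -/
theorem Polynomial.eq_zero_of_eval_natCast_eq_zero (P : Polynomial B)
    (h : ∀ n : ℕ, P.eval (algebraMap K B n) = 0) : P = 0 := by
  ext k
  rw [Polynomial.coeff_zero, ← Module.forall_dual_apply_eq_zero_iff K]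
  intro f
  let Q : Polynomial K := ∑ k ∈ Finset.range (P.natDegree + 1),
    Polynomial.monomial k (f (P.coeff k))
  have hQ : Q = 0 := by
    refine Polynomial.eq_zero_of_infinite_isRoot Q ?_
    refine (Set.infinite_range_of_injective (Nat.cast_injective (R := K))).mono ?_
    rintro _ ⟨n, rfl⟩
    have h1 := congrArg f (h n)
    rw [Polynomial.eval_eq_sum_range, map_sum, map_zero] at h1
    rw [Set.mem_ofPred_eq, Polynomial.IsRoot, ← h1, Polynomial.eval_finsetSum]
    refine Finset.sum_congr rfl fun k _ => ?_
    rw [Polynomial.eval_monomial, ← map_pow, mul_comm (P.coeff k), ← Algebra.smul_def, map_smul,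
      smul_eq_mul, mul_comm]
  have h2 := congrArg (Polynomial.coeff · k) hQ
  simp only [Q, Polynomial.finsetSum_coeff, Polynomial.coeff_monomial, Polynomial.coeff_zero,
    Finset.sum_ite_eq', Finset.mem_range] at h2
  by_cases hk : k < P.natDegree + 1
  · rwa [if_pos hk] at h2
  · rw [Polynomial.coeff_eq_zero_of_natDegree_lt (by omega), map_zero]

namespace CharGroup

theorem toConvAlg_apply_one (χ : CharGroup K H B) : toConvAlg χ 1 = 1 :=
  map_one (WithConv.ofConv (A := H →ₐ[K] B) χ)

theorem toConvAlg_apply_mul (χ : CharGroup K H B) (a b : H) :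
    toConvAlg χ (a * b) = toConvAlg χ a * toConvAlg χ b :=
  map_mul (WithConv.ofConv (A := H →ₐ[K] B) χ) a b

theorem toConvAlg_pow (χ : CharGroup K H B) (n : ℕ) : toConvAlg (χ ^ n) = toConvAlg χ ^ n := by
  induction n with
  | zero => rfl
  | succ n ih => rw [pow_succ, pow_succ, toConvAlg_mul, ih]

end CharGroup

variable {𝒜 : ℕ → Submodule K H}

theorem InfChar.mem_vanishBelow (h𝒜 : IsConnectedHopfGrading 𝒜) {φ : ConvAlg K H B}
    (hφ : φ ∈ InfChar K H B) : φ ∈ vanishBelow B 𝒜 1 :=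
  (mem_vanishBelow_one h𝒜).2 (apply_one_of_mem_infChar hφ)

theorem CharGroup.sub_one_mem_vanishBelow (h𝒜 : IsConnectedHopfGrading 𝒜) (χ : CharGroup K H B) :
    CharGroup.toConvAlg χ - 1 ∈ vanishBelow B 𝒜 1 := by
  refine (mem_vanishBelow_one h𝒜).2 ?_
  change CharGroup.toConvAlg χ 1 - (1 : ConvAlg K H B) 1 = 0
  rw [CharGroup.toConvAlg_apply_one]
  simp

end Characters

section CharactersTopology

open Coalgebra

variable {K : Type*} [RCLike K] {H : Type*} [Ring H] [HopfAlgebra K H]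
  {B : Type*} [CommRing B] [Algebra K B] [TopologicalSpace B]

namespace CharGroup

theorem isInducing_toConvAlg :
    Topology.IsInducing (toConvAlg : CharGroup K H B → ConvAlg K H B) := ⟨rfl⟩

theorem continuous_iff {X : Type*} [TopologicalSpace X] {f : X → CharGroup K H B} :
    Continuous f ↔ ∀ a, Continuous fun x => toConvAlg (f x) a := by
  rw [isInducing_toConvAlg.continuous_iff, ConvAlg.continuous_iff]
  rfl

theorem continuous_apply (a : H) : Continuous fun χ : CharGroup K H B => toConvAlg χ a :=
  continuous_iff.1 continuous_id a

instance [T2Space B] : T2Space (CharGroup K H B) :=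
  T2Space.of_injective_continuous toConvAlg_injective isInducing_toConvAlg.continuous

instance [IsTopologicalRing B] : IsTopologicalGroup (CharGroup K H B) where
  continuous_mul := continuous_iff.2 fun a => by
    simp only [toConvAlg_mul, (Coalgebra.Repr.arbitrary K a).convMul_apply]
    exact continuous_finsetSum _ fun i _ => ((continuous_apply _).comp continuous_fst).mul
      ((continuous_apply _).comp continuous_snd)
  continuous_inv := continuous_iff.2 fun a => continuous_apply (HopfAlgebra.antipode K a)

end CharGroup

variable {𝒜 : ℕ → Submodule K H}

variable [T2Space B]

theorem convExp_apply_one (h𝒜 : IsConnectedHopfGrading 𝒜) {φ : ConvAlg K H B}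
    (hφ : φ ∈ vanishBelow B 𝒜 1) : convExp φ 1 = 1 := by
  have h1 : convExp φ 1 - (1 : ConvAlg K H B) 1 = 0 :=
    (mem_vanishBelow_one h𝒜).1 (convExp_sub_one_mem h𝒜 hφ)
  rw [sub_eq_zero.1 h1]
  simp

/-- The exponential of an infinitesimal character is a character. -/
theorem convExp_apply_mul [IsTopologicalRing B] (h𝒜 : IsConnectedHopfGrading 𝒜)
    {φ : ConvAlg K H B} (hφ : φ ∈ InfChar K H B) (a b : H) :
    convExp φ (a * b) = convExp φ a * convExp φ b := by
  let e (n : ℕ) : ConvAlg K H B := ((n.factorial : K)⁻¹) • φ ^ n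
  have hφ1 := InfChar.mem_vanishBelow h𝒜 hφ
  have hsum (a : H) : HasSum (fun n => e n a) (convExp φ a) :=
    ConvAlg.hasSum_iff.1 (hasSum_convExp h𝒜 hφ1) a
  have hfin (a : H) : (Function.support fun n => e n a).Finite := by
    obtain ⟨N, hN⟩ := exists_forall_vanishBelow_apply (B := B) h𝒜 a
    refine (Set.finite_lt_nat N).subset fun n hn => ?_
    by_contra h
    exact hn (hN _ (Submodule.smul_mem _ _
      (vanishBelow_antitone (not_lt.1 h) (pow_mem_vanishBelow h𝒜 hφ1 n))))
  have hprod : Summable fun x : ℕ × ℕ => e x.1 a * e x.2 b := by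
    refine summable_of_hasFiniteSupport (((hfin a).prod (hfin b)).subset fun x hx => ⟨?_, ?_⟩)
    · exact left_ne_zero_of_mul hx
    · exact right_ne_zero_of_mul hx
  rw [← (hsum (a * b)).tsum_eq, ← (hsum a).tsum_eq, ← (hsum b).tsum_eq,
    (hsum a).summable.tsum_mul_tsum_eq_tsum_sum_antidiagonal (hsum b).summable hprod]
  exact tsum_congr fun n => InfChar.dividedPow_apply_mul hφ n a b

/-- The logarithm of a character is an infinitesimal character: the powers of the character are
characters and depend polynomially on the exponent, hence so does the multiplicativity relation,
whose linear coefficient is the relation that defines infinitesimal characters. -/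
theorem convLog_mem_infChar (h𝒜 : IsConnectedHopfGrading 𝒜) (χ : CharGroup K H B) :
    convLog (CharGroup.toConvAlg χ) ∈ InfChar K H B := by
  intro a b
  have hχ := CharGroup.sub_one_mem_vanishBelow h𝒜 χ
  set φ := convLog (CharGroup.toConvAlg χ) with hφdef
  have hφ : φ ∈ vanishBelow B 𝒜 1 := convLog_mem h𝒜 hχ
  let e (n : ℕ) : ConvAlg K H B := ((n.factorial : K)⁻¹) • φ ^ n
  have hP (x : H) : ∃ P : Polynomial B, P.coeff 0 = algebraMap K B (counit x) ∧ P.coeff 1 = φ x ∧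
      ∀ n : ℕ, P.eval (algebraMap K B n) = CharGroup.toConvAlg (χ ^ n) x := by
    obtain ⟨N, hN⟩ := exists_forall_vanishBelow_apply (B := B) h𝒜 x
    refine ⟨∑ k ∈ Finset.range (N + 2), Polynomial.monomial k (e k x), ?_, ?_, fun n => ?_⟩
    · simp [Polynomial.coeff_monomial, e]
    · simp [Polynomial.coeff_monomial, e]
    · rw [CharGroup.toConvAlg_pow, ← convExp_convLog h𝒜 hχ, ← hφdef,
        ← convExp_natCast_smul h𝒜 hφ]
      have h1 : convExp ((n : K) • φ) x - (∑ k ∈ Finset.range (N + 2),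
          ((k.factorial : K)⁻¹) • ((n : K) • φ) ^ k) x = 0 :=
        hN _ (vanishBelow_antitone (by omega : N ≤ N + 2)
        (convExp_sub_sum_mem h𝒜 (Submodule.smul_mem _ (n : K) hφ) (N + 2)))
      refine Eq.trans ?_ (sub_eq_zero.1 h1).symm
      rw [ConvAlg.sum_apply, Polynomial.eval_finsetSum]
      refine Finset.sum_congr rfl fun k _ => ?_
      rw [Polynomial.eval_monomial, smul_pow, smul_comm, ← map_pow, mul_comm, ← Algebra.smul_def]
      rfl
  choose P hP0 hP1 hP using hP
  have h1 : P (a * b) = P a * P b := by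
    refine sub_eq_zero.1 (Polynomial.eq_zero_of_eval_natCast_eq_zero (K := K) _ fun n => ?_)
    rw [Polynomial.eval_sub, Polynomial.eval_mul, hP, hP, hP, CharGroup.toConvAlg_apply_mul,
      sub_self]
  rw [← hP1, h1, Polynomial.mul_coeff_one, hP0, hP0, hP1, hP1, Algebra.smul_def, Algebra.smul_def,
    mul_comm (φ a)]

end CharactersTopology

/-! ### The space of infinitesimal characters -/

section Transfer

variable {K : Type*} [RCLike K] {B : Type*} [AddCommGroup B] [Module K B] [TopologicalSpace B]
  {E : Type*} [AddCommGroup E] [Module K E] [TopologicalSpace E] {ι : Type*}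

theorem IsLocallyConvexTVS.of_equiv_pi (hB : IsLocallyConvexTVS K B) (Φ : E ≃L[K] (ι → B)) :
    IsLocallyConvexTVS K E := by
  have := hB.topologicalAddGroup
  have := hB.continuousSMul
  have := hB.t2
  have hi : Topology.IsInducing Φ := Φ.toHomeomorph.isInducing
  refine ⟨hi.topologicalAddGroup Φ, hi.continuousSMul continuous_id fun {c x} => map_smul Φ c x,
    Φ.toHomeomorph.symm.t2Space, ?_⟩
  let : Module ℝ E := Module.compHom E (algebraMap ℝ K)
  let : Module ℝ B := Module.compHom B (algebraMap ℝ K)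
  have : LocallyConvexSpace ℝ B := hB.locallyConvex
  let l : E →ₗ[ℝ] (ι → B) :=
    { toFun := Φ
      map_add' := map_add Φ
      map_smul' := fun r x => map_smul Φ (algebraMap ℝ K r) x }
  exact Topology.IsInducing.locallyConvexSpace (f := l) hi

theorem IsFrechet.of_equiv_pi [Countable ι] (hB : IsFrechet K B) (Φ : E ≃L[K] (ι → B)) :
    IsFrechet K E := by
  have hE := hB.isLocallyConvexTVS.of_equiv_pi Φ
  have := hE.topologicalAddGroup
  have := hB.metrizable
  obtain ⟨_, hc⟩ := hB.complete
  let : UniformSpace B := IsTopologicalAddGroup.rightUniformSpace B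
  have : IsUniformAddGroup B := isUniformAddGroup_of_addCommGroup
  have : (uniformity B).IsCountablyGenerated := IsUniformAddGroup.uniformity_countably_generated
  have : TopologicalSpace.MetrizableSpace (ι → B) := UniformSpace.metrizableSpace
  refine ⟨hE, Φ.toHomeomorph.isEmbedding.metrizableSpace, ‹_›, ?_⟩
  let : UniformSpace E := IsTopologicalAddGroup.rightUniformSpace E
  have : IsUniformAddGroup E := isUniformAddGroup_of_addCommGroup
  have h1 : IsUniformEmbedding Φ.toEquiv := Φ.isUniformEmbedding
  exact (completeSpace_congr h1).2 inferInstance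

end Transfer

theorem IsWeaklyComplete.of_equiv_pi.{u, v} {K : Type*} [RCLike K] {B : Type u} [AddCommGroup B]
    [Module K B] [TopologicalSpace B] {ι : Type v} {E : Type max u v} [AddCommGroup E] [Module K E]
    [TopologicalSpace E] (hB : IsWeaklyComplete K B) (Φ : E ≃L[K] (ι → B)) :
    IsWeaklyComplete K E := by
  obtain ⟨J, ⟨e⟩⟩ := hB
  let Ψ : (ι → B) ≃L[K] (ι × J → K) :=
    { toFun := fun f p => e (f p.1) p.2
      invFun := fun g i => e.symm fun j => g (i, j)
      left_inv := fun f => funext fun i => e.symm_apply_apply (f i)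
      right_inv := fun g => by
        funext p
        simp
      map_add' := fun f g => funext fun p => by simp
      map_smul' := fun c f => funext fun p => by simp
      continuous_toFun := continuous_pi fun p =>
        (continuous_apply p.2).comp (e.continuous.comp (continuous_apply p.1))
      continuous_invFun := continuous_pi fun i =>
        e.symm.continuous.comp (continuous_pi fun j => continuous_apply (i, j)) }
  exact ⟨ι × J, ⟨Φ.trans Ψ⟩⟩

section InfCharEquiv

universe u

variable (K : Type*) [RCLike K] (H : Type u) [Ring H] [HopfAlgebra K H]
  (B : Type*) [CommRing B] [Algebra K B] [TopologicalSpace B]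

/-- The inclusion of the infinitesimal characters into the convolution algebra. -/
def InfChar.inclusion : InfChar K H B →L[K] ConvAlg K H B where
  toFun x := x
  map_add' _ _ := rfl
  map_smul' _ _ := rfl
  cont := continuous_subtype_val

variable {K H B} in
@[simp] theorem InfChar.inclusion_apply (x : InfChar K H B) :
    InfChar.inclusion K H B x = (x : ConvAlg K H B) := rfl

theorem InfChar.exists_equiv_pi [IsTopologicalRing B] [ContinuousSMul K B] :
    ∃ (ι : Type u) (h : ι → H) (Φ : InfChar K H B ≃L[K] (ι → B)),
      (∀ x i, Φ x i = (x : ConvAlg K H B) (h i)) ∧ Cardinal.mk ι ≤ Module.rank K H :=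
  exists_equiv_pi_of_range_eq (InfChar.inclusion K H B) Topology.IsEmbedding.subtypeVal _
    fun φ => Iff.trans ⟨fun ⟨x, hx⟩ => hx ▸ x.2, fun h => ⟨⟨φ, h⟩, rfl⟩⟩
      mem_infChar_iff_forall_span

end InfCharEquiv

/-! ### Analyticity of pointwise polynomial maps -/

section Class

variable {K : Type*} [RCLike K] {H : Type*} [Ring H] [HopfAlgebra K H]
  {B : Type*} [CommRing B] [Algebra K B] [TopologicalSpace B] [IsTopologicalRing B]
  [ContinuousSMul K B]
  {E : Type*} [AddCommGroup E] [Module K E] [TopologicalSpace E]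

theorem IsPointwisePoly.isClassOn {f : E → ConvAlg K H B} (hf : IsPointwisePoly f)
    (r : WithTop ℕ∞) (U : Set E) : IsClassOn K r f U := by
  obtain ⟨ι, h, Φ, hΦ⟩ := ConvAlg.exists_equiv_pi K H B
  exact isClassOn_of_isPolyMap Φ (fun i => by simpa only [hΦ] using hf (h i)) r U

theorem IsPointwisePoly.isClassOn_infChar {f : E → InfChar K H B}
    (hf : IsPointwisePoly fun x => (f x : ConvAlg K H B))
    (r : WithTop ℕ∞) (U : Set E) : IsClassOn K r f U := by
  obtain ⟨ι, h, Φ, hΦ, -⟩ := InfChar.exists_equiv_pi K H B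
  exact isClassOn_of_isPolyMap Φ (fun i => by simpa only [hΦ] using hf (h i)) r U

theorem isClassOn_id_infChar (r : WithTop ℕ∞) (U : Set (InfChar K H B)) :
    IsClassOn K r (fun x : InfChar K H B => x) U :=
  (IsPointwisePoly.clm (InfChar.inclusion K H B)).isClassOn_infChar r U

end Class

section ContinuousSMul

variable {K : Type*} [RCLike K] {H : Type*} [Ring H] [HopfAlgebra K H]
  {B : Type*} [CommRing B] [Algebra K B] [TopologicalSpace B] [ContinuousSMul K B]

instance : ContinuousSMul K (ConvAlg K H B) :=
  ConvAlg.isInducing_coe.continuousSMul continuous_id rfl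

instance : ContinuousSMul K (InfChar K H B) :=
  have h : Topology.IsInducing (InfChar.inclusion K H B) := Topology.IsInducing.subtypeVal
  h.continuousSMul continuous_id rfl

end ContinuousSMul

/-! ### Expansion of the exponential map along curves -/

section Order

variable {K : Type*} [RCLike K] {H : Type*} [Ring H] [HopfAlgebra K H]
  {B : Type*} [CommRing B] [Algebra K B] [TopologicalSpace B]

/-- A curve in the convolution algebra vanishes to order `k` at `0` if each of its evaluations is
`s ^ k` times a continuous function of `s`. -/
def VanishesToOrder (k : ℕ) (r : K → ConvAlg K H B) : Prop :=
  ∀ a, ∃ ρ : K → B, Continuous ρ ∧ ∀ s, r s a = s ^ k • ρ s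

namespace VanishesToOrder

variable {r r' : K → ConvAlg K H B} {j k : ℕ}

theorem const (φ : ConvAlg K H B) : VanishesToOrder 0 fun _ : K => φ :=
  fun a => ⟨fun _ => φ a, continuous_const, fun s => by rw [pow_zero, one_smul]⟩

theorem smul_const (φ : ConvAlg K H B) : VanishesToOrder 1 fun s : K => s • φ :=
  fun a => ⟨fun _ => φ a, continuous_const, fun s => by rw [pow_one]; rfl⟩

theorem mono [ContinuousSMul K B] (hjk : j ≤ k) (h : VanishesToOrder k r) :
    VanishesToOrder j r := by
  intro a
  obtain ⟨ρ, hρ, hr⟩ := h a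
  refine ⟨fun s => s ^ (k - j) • ρ s, by fun_prop, fun s => ?_⟩
  rw [hr, smul_smul, ← pow_add, Nat.add_sub_cancel' hjk]

variable [IsTopologicalRing B]

theorem add (h : VanishesToOrder k r) (h' : VanishesToOrder k r') :
    VanishesToOrder k fun s => r s + r' s := by
  intro a
  obtain ⟨ρ, hρ, hr⟩ := h a
  obtain ⟨ρ', hρ', hr'⟩ := h' a
  refine ⟨fun s => ρ s + ρ' s, hρ.add hρ', fun s => ?_⟩
  change r s a + r' s a = _
  rw [hr, hr', smul_add]

theorem sub (h : VanishesToOrder k r) (h' : VanishesToOrder k r') :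
    VanishesToOrder k fun s => r s - r' s := by
  intro a
  obtain ⟨ρ, hρ, hr⟩ := h a
  obtain ⟨ρ', hρ', hr'⟩ := h' a
  refine ⟨fun s => ρ s - ρ' s, hρ.sub hρ', fun s => ?_⟩
  change r s a - r' s a = _
  rw [hr, hr', smul_sub]

theorem mul (h : VanishesToOrder j r) (h' : VanishesToOrder k r') :
    VanishesToOrder (j + k) fun s => r s * r' s := by
  intro a
  choose ρ hρ hr using h
  choose ρ' hρ' hr' using h'
  let R := Coalgebra.Repr.arbitrary K a
  refine ⟨fun s => ∑ i ∈ R.index, ρ (R.left i) s * ρ' (R.right i) s,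
    continuous_finsetSum _ fun i _ => (hρ _).mul (hρ' _), fun s => ?_⟩
  rw [R.convMul_apply, Finset.smul_sum]
  refine Finset.sum_congr rfl fun i _ => ?_
  rw [hr, hr', smul_mul_smul_comm, pow_add]

theorem pow (h : VanishesToOrder 1 r) (n : ℕ) : VanishesToOrder n fun s => r s ^ n := by
  induction n with
  | zero => simpa using const 1
  | succ n ih => simpa only [pow_succ] using ih.mul h

variable [ContinuousSMul K B]

/-- Taylor's formula for the exponential map along a curve through `0`. -/
theorem convExp_sub_sum [T2Space B] {𝒜 : ℕ → Submodule K H} (h𝒜 : IsConnectedHopfGrading 𝒜)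
    (h : VanishesToOrder 1 r) (hr : ∀ s, r s ∈ vanishBelow B 𝒜 1) (k : ℕ) :
    VanishesToOrder k fun s =>
      convExp (r s) - ∑ n ∈ Finset.range k, ((n.factorial : K)⁻¹) • r s ^ n := by
  intro a
  obtain ⟨N, hN⟩ := exists_forall_vanishBelow_apply (B := B) h𝒜 a
  choose ρ hρ hpow using fun n => (h.pow n).mono (min_le_right k n) a
  refine ⟨fun s => ∑ n ∈ Finset.range N, ((n + k).factorial : K)⁻¹ • ρ (n + k) s,
    continuous_finsetSum _ fun n _ => (hρ _).const_smul _, fun s => ?_⟩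
  have h1 : convExp (r s) a - (∑ n ∈ Finset.range (N + k), ((n.factorial : K)⁻¹) • r s ^ n) a = 0 :=
    hN _ (vanishBelow_antitone (N.le_add_right k) (convExp_sub_sum_mem h𝒜 (hr s) (N + k)))
  change convExp (r s) a - (∑ n ∈ Finset.range k, ((n.factorial : K)⁻¹) • r s ^ n) a = _
  rw [sub_eq_zero.1 h1, add_comm N, Finset.smul_sum]
  simp only [ConvAlg.sum_apply]
  rw [Finset.sum_range_add, add_sub_cancel_left]
  refine Finset.sum_congr rfl fun n _ => ?_
  change ((k + n).factorial : K)⁻¹ • (r s ^ (k + n)) a = _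
  rw [hpow, min_eq_left (k.le_add_right n), smul_comm, add_comm k n]

end VanishesToOrder

/-- The exponential map has the identity as its derivative at `0`. -/
theorem hasDirDeriv_convExp_zero [IsTopologicalRing B] [ContinuousSMul K B] [T2Space B]
    {𝒜 : ℕ → Submodule K H} (h𝒜 : IsConnectedHopfGrading 𝒜) {φ : ConvAlg K H B}
    (hφ : φ ∈ vanishBelow B 𝒜 1) : 
    HasDirDeriv K (convExp : ConvAlg K H B → ConvAlg K H B) 0 φ φ := by
  refine ConvAlg.tendsto_iff.2 fun a => ?_
  obtain ⟨ρ, hρ, h⟩ := (VanishesToOrder.smul_const (K := K) φ).convExp_sub_sum h𝒜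
    (fun s => Submodule.smul_mem _ s hφ) 2 a
  have h1 : Tendsto (fun s : K => φ a + s • ρ s) (𝓝[≠] 0) (𝓝 (φ a + (0 : K) • ρ 0)) :=
    (Continuous.tendsto (by fun_prop) _).mono_left nhdsWithin_le_nhds
  rw [zero_smul, add_zero] at h1
  refine h1.congr' ?_
  filter_upwards [self_mem_nhdsWithin] with s hs
  have h2 := h s
  simp only [Finset.sum_range_succ, Finset.sum_range_zero, Nat.factorial, pow_zero, pow_one,
    zero_add, mul_one, Nat.cast_one, inv_one, one_smul] at h2
  change φ a + s • ρ s =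
    s⁻¹ • (convExp ((0 : ConvAlg K H B) + s • φ) a - convExp (0 : ConvAlg K H B) a)
  rw [zero_add, convExp_zero, eq_comm, inv_smul_eq_iff₀ hs, smul_add, smul_smul, ← pow_two, ← h2]
  change _ = s • φ a + (convExp (s • φ) a - ((1 : ConvAlg K H B) a + s • φ a))
  abel

theorem isPointwisePoly_convExp_coe [T2Space B]
    {𝒜 : ℕ → Submodule K H} (h𝒜 : IsConnectedHopfGrading 𝒜) :
    IsPointwisePoly fun x : InfChar K H B => convExp (x : ConvAlg K H B) :=
  (IsPointwisePoly.clm (InfChar.inclusion K H B)).convExp h𝒜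
    fun x => InfChar.mem_vanishBelow h𝒜 x.2

end Order

/-! ### Exponential coordinates on the character group -/

section ExpChart

variable {K : Type*} [RCLike K] {H : Type*} [Ring H] [HopfAlgebra K H]
  {B : Type*} [CommRing B] [Algebra K B] [TopologicalSpace B] [IsTopologicalRing B] [T2Space B]
  {𝒜 : ℕ → Submodule K H} (h𝒜 : IsConnectedHopfGrading 𝒜)

/-- The exponential map from the infinitesimal characters to the characters. -/
def charExp (x : InfChar K H B) : CharGroup K H B :=
  WithConv.toConv (A := H →ₐ[K] B) (AlgHom.ofLinearMap (convExp (x : ConvAlg K H B)).ofConv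
    (convExp_apply_one h𝒜 (InfChar.mem_vanishBelow h𝒜 x.2)) (convExp_apply_mul h𝒜 x.2))

/-- The logarithm of a character. -/
def charLog (χ : CharGroup K H B) : InfChar K H B :=
  ⟨convLog (CharGroup.toConvAlg χ), convLog_mem_infChar h𝒜 χ⟩

@[simp] theorem toConvAlg_charExp (x : InfChar K H B) :
    CharGroup.toConvAlg (charExp h𝒜 x) = convExp (x : ConvAlg K H B) := rfl

theorem charLog_charExp (x : InfChar K H B) : charLog h𝒜 (charExp h𝒜 x) = x :=
  Subtype.ext (convLog_convExp h𝒜 (InfChar.mem_vanishBelow h𝒜 x.2))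

theorem charExp_charLog (χ : CharGroup K H B) : charExp h𝒜 (charLog h𝒜 χ) = χ :=
  CharGroup.toConvAlg_injective (convExp_convLog h𝒜 (CharGroup.sub_one_mem_vanishBelow h𝒜 χ))

theorem charExp_add_smul (x : InfChar K H B) (s t : K) :
    charExp h𝒜 ((s + t) • x) = charExp h𝒜 (s • x) * charExp h𝒜 (t • x) :=
  CharGroup.toConvAlg_injective (convExp_add_smul h𝒜 (InfChar.mem_vanishBelow h𝒜 x.2) s t)

theorem charExp_zero : charExp h𝒜 (0 : InfChar K H B) = 1 :=
  CharGroup.toConvAlg_injective convExp_zero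

theorem charLog_one : charLog h𝒜 (1 : CharGroup K H B) = 0 := by
  rw [← charExp_zero h𝒜, charLog_charExp]

theorem charExp_neg (x : InfChar K H B) : charExp h𝒜 (-x) = (charExp h𝒜 x)⁻¹ := by
  refine eq_inv_of_mul_eq_one_left ?_
  have h1 := charExp_add_smul h𝒜 x (-1) 1
  rw [neg_add_cancel, zero_smul, charExp_zero, neg_one_smul, one_smul] at h1
  exact h1.symm

/-- The logarithm is continuous, being pointwise polynomial on the affine space of linear maps
with value `1` at `1`. -/
theorem continuous_charLog : Continuous (charLog h𝒜 : CharGroup K H B → InfChar K H B) := by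
  refine continuous_induced_rng.2 ?_
  let l : vanishBelow B 𝒜 1 →L[K] ConvAlg K H B :=
    ⟨(vanishBelow B 𝒜 1).subtype, continuous_subtype_val⟩
  have h1 : IsPointwisePoly fun x : vanishBelow B 𝒜 1 => convLog (1 + l x) :=
    ((IsPointwisePoly.const 1).add (.clm l)).convLog h𝒜 fun x => by
      rw [add_sub_cancel_left]
      exact x.2
  have h2 : Continuous fun χ : CharGroup K H B =>
      (⟨CharGroup.toConvAlg χ - 1, CharGroup.sub_one_mem_vanishBelow h𝒜 χ⟩ : vanishBelow B 𝒜 1) :=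
    continuous_induced_rng.2 (ConvAlg.continuous_iff.2 fun a =>
      (CharGroup.continuous_apply a).sub continuous_const)
  refine (h1.continuous.comp h2).congr fun χ => ?_
  change convLog (1 + (CharGroup.toConvAlg χ - 1)) = convLog (CharGroup.toConvAlg χ)
  rw [add_sub_cancel]

/-- The exponential map as a homeomorphism; its inverse is the global chart of the group. -/
def charExpHomeomorph : InfChar K H B ≃ₜ CharGroup K H B where
  toFun := charExp h𝒜
  invFun := charLog h𝒜
  left_inv := charLog_charExp h𝒜
  right_inv := charExp_charLog h𝒜
  continuous_toFun := CharGroup.isInducing_toConvAlg.continuous_iff.2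
    (isPointwisePoly_convExp_coe h𝒜).continuous
  continuous_invFun := continuous_charLog h𝒜

/-- The group multiplication in exponential coordinates, that is, the
Baker--Campbell--Hausdorff product. -/
def bchMul (x y : InfChar K H B) : InfChar K H B := charLog h𝒜 (charExp h𝒜 x * charExp h𝒜 y)

theorem coe_bchMul (x y : InfChar K H B) : (bchMul h𝒜 x y : ConvAlg K H B) =
    convLog (convExp (x : ConvAlg K H B) * convExp (y : ConvAlg K H B)) := rfl

theorem convExp_bchMul (x y : InfChar K H B) : convExp (bchMul h𝒜 x y : ConvAlg K H B) =
    convExp (x : ConvAlg K H B) * convExp (y : ConvAlg K H B) :=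
  congrArg CharGroup.toConvAlg (charExp_charLog h𝒜 (charExp h𝒜 x * charExp h𝒜 y))

theorem bchMul_zero (x : InfChar K H B) : bchMul h𝒜 x 0 = x := by
  rw [bchMul, charExp_zero, mul_one, charLog_charExp]

theorem zero_bchMul (x : InfChar K H B) : bchMul h𝒜 0 x = x := by
  rw [bchMul, charExp_zero, one_mul, charLog_charExp]

theorem isPointwisePoly_bchMul : IsPointwisePoly fun p : InfChar K H B × InfChar K H B =>
    (bchMul h𝒜 p.1 p.2 : ConvAlg K H B) := by
  have h0 := isPointwisePoly_convExp_coe (K := K) (H := H) (B := B) h𝒜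
  have h1 := h0.comp_clm (ContinuousLinearMap.fst K (InfChar K H B) (InfChar K H B))
  have h2 := h0.comp_clm (ContinuousLinearMap.snd K (InfChar K H B) (InfChar K H B))
  have h3 (p : InfChar K H B × InfChar K H B) :
      convExp (p.1 : ConvAlg K H B) * convExp (p.2 : ConvAlg K H B) - 1 ∈ vanishBelow B 𝒜 1 := by
    rw [← toConvAlg_charExp h𝒜, ← toConvAlg_charExp h𝒜, ← CharGroup.toConvAlg_mul]
    exact CharGroup.sub_one_mem_vanishBelow h𝒜 _
  have h4 := (h1.mul h2).convLog h𝒜 h3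
  simp only [coe_bchMul]
  exact h4

/-! ### The second order term of the multiplication -/

section Bracket

variable [ContinuousSMul K B]

/-- As `bchMul` has `0` as a neutral element on both sides, its expansion on a pair of lines has
linear terms `s v + t w`, and all other terms are divisible by `s t`. -/
theorem exists_bchMul_expansion (v w : InfChar K H B) :
    ∃ N : H → K × K → B, (∀ a, Continuous (N a)) ∧ ∀ a s t,
      (bchMul h𝒜 (s • v) (t • w) : ConvAlg K H B) a =
        s • (v : ConvAlg K H B) a + t • (w : ConvAlg K H B) a + (s * t) • N a (s, t) := by
  let T : K × K →L[K] InfChar K H B × InfChar K H B :=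
    (ContinuousLinearMap.toSpanSingleton K v).prodMap (ContinuousLinearMap.toSpanSingleton K w)
  choose α β N hN _ _ h using fun a =>
    IsPolyMap.exists_mixed_expansion ((isPointwisePoly_bchMul h𝒜).comp_clm T a)
  have h' (a : H) (s t : K) : (bchMul h𝒜 (s • v) (t • w) : ConvAlg K H B) a =
      s • α a s + t • β a t + (s * t) • N a (s, t) := by
    have h0 : (bchMul h𝒜 (T 0).1 (T 0).2 : ConvAlg K H B) a = 0 := by
      rw [map_zero, Prod.fst_zero, Prod.snd_zero, bchMul_zero]
      rfl
    have h1 := h a s t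
    rw [h0, zero_add] at h1
    exact h1
  refine ⟨N, hN, fun a s t => ?_⟩
  have hs := h' a s 0
  have ht := h' a 0 t
  rw [zero_smul, bchMul_zero, mul_zero, zero_smul, zero_smul, add_zero, add_zero] at hs
  rw [zero_smul, zero_bchMul, zero_mul, zero_smul, zero_smul, zero_add, add_zero] at ht
  rw [h', ← hs, ← ht]
  rfl

/-- The mixed second order term of the multiplication is half the commutator. It is read off from
the terms of order `s ^ 2` in `exp (bchMul (s v) (s w)) = exp (s v) * exp (s w)`. -/
theorem bchMul_mixed_term (v w : InfChar K H B) {N : H → K × K → B} (hN : ∀ a, Continuous (N a))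
    (h : ∀ a s t, (bchMul h𝒜 (s • v) (t • w) : ConvAlg K H B) a =
      s • (v : ConvAlg K H B) a + t • (w : ConvAlg K H B) a + (s * t) • N a (s, t)) (a : H) :
    N a 0 = (2⁻¹ : K) • (⁅v, w⁆ : InfChar K H B).1 a := by
  let V (s : K) : ConvAlg K H B := s • v
  let W (s : K) : ConvAlg K H B := s • w
  let m (s : K) : ConvAlg K H B := bchMul h𝒜 (s • v) (s • w)
  let q (s : K) : ConvAlg K H B := m s - V s - W s
  -- twice the Taylor remainder; the factor keeps the coefficients below integral, so that the
  -- comparison is an identity in a noncommutative ring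
  let R (r : K → ConvAlg K H B) (s : K) : ConvAlg K H B :=
    2 * (convExp (r s) - ∑ n ∈ Finset.range 3, ((n.factorial : K)⁻¹) • r s ^ n)
  have hR (r : K → ConvAlg K H B) (s : K) : 2 * convExp (r s) = 2 + 2 * r s + r s ^ 2 + R r s := by
    simp only [R, Finset.sum_range_succ, Finset.sum_range_zero, Nat.factorial, mul_sub, mul_add]
    have h2 : (2 : ConvAlg K H B) * ((((Nat.succ 1 * (Nat.succ 0 * 1) : ℕ) : K)⁻¹) • r s ^ 2) =
        r s ^ 2 := by
      rw [two_mul, ← two_smul K, smul_smul]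
      norm_num
    rw [h2]
    simp
  have hV : VanishesToOrder 1 V := .smul_const _
  have hW : VanishesToOrder 1 W := .smul_const _
  have hq : VanishesToOrder 2 q := fun b => ⟨fun s => N b (s, s), by fun_prop, fun s => by
    change m s b - s • (v : ConvAlg K H B) b - s • (w : ConvAlg K H B) b = _
    rw [show m s b = _ from h b s s, pow_two]
    abel⟩
  have hm : VanishesToOrder 1 m := by
    have h1 := (hq.mono one_le_two).add (hV.add hW)
    convert h1 using 2 with s
    simp only [q]
    abel
  have hmem (x : InfChar K H B) : (x : ConvAlg K H B) ∈ vanishBelow B 𝒜 1 :=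
    InfChar.mem_vanishBelow h𝒜 x.2
  have hRV : VanishesToOrder 3 (R V) := by
    simpa using (VanishesToOrder.const 2).mul
      (hV.convExp_sub_sum h𝒜 (fun s => hmem (s • v)) 3)
  have hRW : VanishesToOrder 3 (R W) := by
    simpa using (VanishesToOrder.const 2).mul
      (hW.convExp_sub_sum h𝒜 (fun s => hmem (s • w)) 3)
  have hRm : VanishesToOrder 3 (R m) := by
    simpa using (VanishesToOrder.const 2).mul
      (hm.convExp_sub_sum h𝒜 (fun s => hmem (bchMul h𝒜 (s • v) (s • w))) 3)
  have hexp (s : K) : 2 * (2 + 2 * m s + m s ^ 2 + R m s) =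
      (2 + 2 * V s + V s ^ 2 + R V s) * (2 + 2 * W s + W s ^ 2 + R W s) := by
    rw [← hR, ← hR, ← hR, show convExp (m s) = _ from convExp_bchMul h𝒜 (s • v) (s • w)]
    change 2 * (2 * (convExp (V s) * convExp (W s))) = 2 * convExp (V s) * (2 * convExp (W s))
    noncomm_ring
  -- all terms of order at least three in the comparison of both sides
  let Z (s : K) : ConvAlg K H B :=
    2 * (V s * W s ^ 2) + 2 * (V s ^ 2 * W s) + V s ^ 2 * W s ^ 2 +
      R V s * (2 + 2 * W s + W s ^ 2 + R W s) + (2 + 2 * V s + V s ^ 2) * R W s -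
      2 * ((V s + W s) * q s) - 2 * (q s * (V s + W s)) - 2 * (q s * q s) - 2 * R m s
  have hZ : VanishesToOrder 3 Z := by
    have c2 : VanishesToOrder 0 fun _ : K => (2 : ConvAlg K H B) := .const 2
    have hV0 := hV.mono zero_le_one
    have hW0 := hW.mono zero_le_one
    have hV2 := (hV.pow 2).mono (Nat.zero_le 2)
    have hW2 := (hW.pow 2).mono (Nat.zero_le 2)
    have t1 := c2.mul (hV.mul (hW.pow 2))
    have t2 := c2.mul ((hV.pow 2).mul hW)
    have t3 := ((hV.pow 2).mul (hW.pow 2)).mono (show 3 ≤ 2 + 2 by norm_num)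
    have t4 := hRV.mul (((c2.add (c2.mul hW0)).add hW2).add (hRW.mono (Nat.zero_le 3)))
    have t5 := ((c2.add (c2.mul hV0)).add hV2).mul hRW
    have t6 := c2.mul ((hV.add hW).mul hq)
    have t7 := c2.mul (hq.mul (hV.add hW))
    have t8 := c2.mul ((hq.mul hq).mono (show 3 ≤ 2 + 2 by norm_num))
    have t9 := c2.mul hRm
    exact (((((((t1.add t2).add t3).add t4).add t5).sub t6).sub t7).sub t8).sub t9
  have hqZ (s : K) : 4 * q s - 2 * (V s * W s - W s * V s) = Z s := by
    have hms : m s = V s + W s + q s := by simp only [q]; abel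
    have h1 := hexp s
    rw [hms] at h1
    rw [← sub_eq_zero]
    rw [← sub_eq_zero] at h1
    rw [← h1]
    simp only [Z]
    noncomm_ring
  obtain ⟨ρ, hρ, hZρ⟩ := hZ a
  have hcomm (s : K) : V s * W s - W s * V s = s ^ 2 • (⁅v, w⁆ : InfChar K H B).1 := by
    change (s • (v : ConvAlg K H B)) * (s • (w : ConvAlg K H B)) -
      (s • (w : ConvAlg K H B)) * (s • (v : ConvAlg K H B)) =
      s ^ 2 • ((v : ConvAlg K H B) * w - (w : ConvAlg K H B) * v)
    rw [smul_mul_smul_comm, smul_mul_smul_comm, smul_sub, pow_two]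
  have hqa (s : K) : q s a = s ^ 2 • N a (s, s) := by
    change m s a - s • (v : ConvAlg K H B) a - s • (w : ConvAlg K H B) a = _
    rw [show m s a = _ from h a s s, pow_two]
    abel
  have hev (s : K) (hs : s ≠ 0) :
      (4 : K) • N a (s, s) - (2 : K) • (⁅v, w⁆ : InfChar K H B).1 a = s • ρ s := by
    have h1 : (4 * q s - 2 * (V s * W s - W s * V s)) a = s ^ 3 • ρ s := by rw [hqZ, hZρ]
    have h4 : 4 * q s = (4 : K) • q s := by
      rw [Algebra.smul_def, map_ofNat]
    have h2 : 2 * (s ^ 2 • (⁅v, w⁆ : InfChar K H B).1) =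
        (2 : K) • (s ^ 2 • (⁅v, w⁆ : InfChar K H B).1) := by
      rw [Algebra.smul_def (2 : K), map_ofNat]
    rw [hcomm, h4, h2] at h1
    change (4 : K) • q s a - (2 : K) • (s ^ 2 • (⁅v, w⁆ : InfChar K H B).1 a) = _ at h1
    rw [hqa, smul_comm, smul_comm (2 : K), ← smul_sub,
      show s ^ 3 = s ^ 2 * s from pow_succ s 2, mul_smul] at h1
    exact smul_right_injective B (pow_ne_zero 2 hs) h1
  have hl : Tendsto (fun s : K => (4 : K) • N a (s, s) - (2 : K) • (⁅v, w⁆ : InfChar K H B).1 a)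
      (𝓝[≠] 0) (𝓝 ((4 : K) • N a (0, 0) - (2 : K) • (⁅v, w⁆ : InfChar K H B).1 a)) := by
    have := hN a
    exact (Continuous.tendsto (f := fun s : K => (4 : K) • N a (s, s) -
      (2 : K) • (⁅v, w⁆ : InfChar K H B).1 a) (by fun_prop) 0).mono_left nhdsWithin_le_nhds
  have hr : Tendsto (fun s : K => s • ρ s) (𝓝[≠] 0) (𝓝 ((0 : K) • ρ 0)) :=
    (Continuous.tendsto (f := fun s : K => s • ρ s) (by fun_prop) 0).mono_left nhdsWithin_le_nhds
  have h0 := tendsto_nhds_unique (hl.congr' (by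
    filter_upwards [self_mem_nhdsWithin] with s hs using hev s hs)) hr
  rw [zero_smul, sub_eq_zero] at h0
  change N a (0, 0) = _
  refine smul_right_injective B (show (4 : K) ≠ 0 by norm_num) ?_
  change (4 : K) • N a (0, 0) = (4 : K) • ((2⁻¹ : K) • _)
  rw [h0, smul_smul]
  norm_num

/-- The left invariant vector field with value `w` at the identity is differentiable there in every
direction `v`, with derivative half the commutator of `v` and `w`. -/
theorem exists_hasDirDeriv_bchMul (v w : InfChar K H B) :
    ∃ Y : K → InfChar K H B, (∀ s, HasDirDeriv K (fun y => bchMul h𝒜 (s • v) y) 0 w (Y s)) ∧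
      Y 0 = w ∧
      Tendsto (fun s => s⁻¹ • (Y s - Y 0)) (𝓝[≠] 0) (𝓝 ((2⁻¹ : K) • ⁅v, w⁆)) := by
  obtain ⟨N, hN, h⟩ := exists_bchMul_expansion h𝒜 v w
  obtain ⟨ι, b, Φ, hΦ, -⟩ := InfChar.exists_equiv_pi K H B
  -- the limit is defined by its coordinates, so that it is an infinitesimal character
  let Y (s : K) : InfChar K H B := Φ.symm fun i => (w : ConvAlg K H B) (b i) + s • N (b i) (s, 0)
  have hY (s : K) (i : ι) : Φ (Y s) i = (w : ConvAlg K H B) (b i) + s • N (b i) (s, 0) := by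
    simp only [Y, ContinuousLinearEquiv.apply_symm_apply]
  have hten {f : K → InfChar K H B} {x : InfChar K H B}
      (hf : ∀ i, Tendsto (fun t => Φ (f t) i) (𝓝[≠] 0) (𝓝 (Φ x i))) :
      Tendsto f (𝓝[≠] 0) (𝓝 x) :=
    (Φ.toHomeomorph.isInducing.tendsto_nhds_iff).2 (tendsto_pi_nhds.2 hf)
  refine ⟨Y, fun s => hten fun i => ?_, ?_, hten fun i => ?_⟩
  · have h1 : Tendsto (fun t : K => (w : ConvAlg K H B) (b i) + s • N (b i) (s, t)) (𝓝[≠] 0)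
        (𝓝 ((w : ConvAlg K H B) (b i) + s • N (b i) (s, 0))) := by
      have := hN (b i)
      exact (Continuous.tendsto (f := fun t : K => (w : ConvAlg K H B) (b i) + s • N (b i) (s, t))
        (by fun_prop) 0).mono_left nhdsWithin_le_nhds
    rw [hY]
    refine h1.congr' ?_
    filter_upwards [self_mem_nhdsWithin] with t ht
    rw [map_smul, map_sub, zero_add, bchMul_zero, Pi.smul_apply, Pi.sub_apply, hΦ, hΦ, h]
    change _ = t⁻¹ • (_ - s • (v : ConvAlg K H B) (b i))
    rw [eq_inv_smul_iff₀ ht]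
    module
  · refine Φ.injective (funext fun i => ?_)
    rw [hY, zero_smul, add_zero, hΦ]
  · have h1 : Tendsto (fun t : K => N (b i) (t, 0)) (𝓝[≠] 0) (𝓝 (N (b i) (0, 0))) := by
      have := hN (b i)
      exact (Continuous.tendsto (f := fun t : K => N (b i) (t, 0))
        (by fun_prop) 0).mono_left nhdsWithin_le_nhds
    have h2 : Φ ((2⁻¹ : K) • ⁅v, w⁆) i = N (b i) (0, 0) := by
      rw [hΦ]
      exact (bchMul_mixed_term h𝒜 v w hN h (b i)).symm
    rw [h2]
    refine h1.congr' ?_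
    filter_upwards [self_mem_nhdsWithin] with t ht
    rw [map_smul, map_sub, Pi.smul_apply, Pi.sub_apply, hY, hY, eq_inv_smul_iff₀ ht]
    simp

theorem hasDirDeriv_dirDeriv_bchMul (v w : InfChar K H B) :
    HasDirDeriv K (fun x => dirDeriv K (fun y => bchMul h𝒜 x y) 0 w) 0 v ((2⁻¹ : K) • ⁅v, w⁆) ∧
      dirDeriv K (fun y => bchMul h𝒜 0 y) 0 w = w := by
  obtain ⟨Y, hY, hY0, hlim⟩ := exists_hasDirDeriv_bchMul h𝒜 v w
  have h1 (s : K) : dirDeriv K (fun y => bchMul h𝒜 (s • v) y) 0 w = Y s := (hY s).dirDeriv_eq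
  have h2 : dirDeriv K (fun y => bchMul h𝒜 0 y) 0 w = Y 0 := by rw [← h1, zero_smul]
  refine ⟨?_, h2.trans hY0⟩
  unfold HasDirDeriv
  simp only [zero_add, h1, h2]
  exact hlim

end Bracket

end ExpChart

/-! ### The Lie group of characters -/

section LieGroup

variable {K : Type*} [RCLike K] {H : Type*} [Ring H] [HopfAlgebra K H]
  {B : Type*} [CommRing B] [Algebra K B] [TopologicalSpace B] [IsTopologicalRing B] [T2Space B]
  {𝒜 : ℕ → Submodule K H} (h𝒜 : IsConnectedHopfGrading 𝒜)

/-- The logarithm as a chart defined on the whole character group. -/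
def logChart : OpenPartialHomeomorph (CharGroup K H B) (InfChar K H B) :=
  (charExpHomeomorph h𝒜).symm.toOpenPartialHomeomorph

/-- The manifold structure on the character group given by the single chart `logChart`. -/
@[reducible]
def charChartedSpace : ChartedSpace (InfChar K H B) (CharGroup K H B) :=
  (logChart h𝒜).singletonChartedSpace rfl

theorem isClassOn_bchMul [ContinuousSMul K B] (r : WithTop ℕ∞)
    (U : Set (InfChar K H B × InfChar K H B)) :
    IsClassOn K r (fun p : InfChar K H B × InfChar K H B => bchMul h𝒜 p.1 p.2) U := by
  have h1 := isPointwisePoly_bchMul (B := B) h𝒜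
  exact h1.isClassOn_infChar r U

theorem isKAnalyticLieGroup_charGroup (hB : IsLocallyConvexTVS K B) :
    letI := charChartedSpace (B := B) h𝒜
    IsKAnalyticLieGroup K (InfChar K H B) (CharGroup K H B) := by
  let := charChartedSpace (B := B) h𝒜
  have := hB.continuousSMul
  obtain ⟨ι, h, Φ, -, -⟩ := InfChar.exists_equiv_pi K H B
  have hat (e) (he : e ∈ atlas (InfChar K H B) (CharGroup K H B)) : e = logChart h𝒜 := he
  refine ⟨⟨hB.of_equiv_pi Φ, inferInstance, fun e he e' he' => ?_⟩, inferInstance,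
    fun e₁ h₁ e₂ h₂ e₃ h₃ => ?_, ?_, fun e he e' he' => ?_⟩
  · rw [hat e he, hat e' he']
    have h1 : (fun x => logChart h𝒜 ((logChart h𝒜).symm x)) = fun x : InfChar K H B => x :=
      funext (charLog_charExp h𝒜)
    rw [h1]
    exact isClassOn_id_infChar _ _
  · rw [hat e₁ h₁, hat e₂ h₂, hat e₃ h₃]
    have h4 : (fun p : InfChar K H B × InfChar K H B =>
        logChart h𝒜 ((logChart h𝒜).symm p.1 * (logChart h𝒜).symm p.2)) =
        fun p => bchMul h𝒜 p.1 p.2 := funext fun _ => rfl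
    rw [h4]
    exact isClassOn_bchMul h𝒜 ω _
  · exact continuous_inv.continuousOn
  · rw [hat e he, hat e' he']
    have h1 : (fun x => logChart h𝒜 ((logChart h𝒜).symm x)⁻¹) = fun x : InfChar K H B => -x :=
      funext fun x => by
        change charLog h𝒜 (charExp h𝒜 x)⁻¹ = -x
        rw [← charExp_neg, charLog_charExp]
    rw [h1]
    refine IsPointwisePoly.isClassOn_infChar ?_ ω _
    simpa using (IsPointwisePoly.clm (InfChar.inclusion K H B)).smul (-1)

theorem isClassMapOn_charExp [ContinuousSMul K B] (r : WithTop ℕ∞) :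
    letI := charChartedSpace (B := B) h𝒜
    IsClassMapOn K (InfChar K H B) (InfChar K H B) r (charExp (B := B) h𝒜) Set.univ := by
  let := charChartedSpace (B := B) h𝒜
  refine ⟨(charExpHomeomorph h𝒜).continuous.continuousOn, fun e he e' he' => ?_⟩
  have h1 : e = OpenPartialHomeomorph.refl _ := he
  have h2 : e' = logChart h𝒜 := he'
  rw [h1, h2]
  have h3 : (fun x => logChart h𝒜 (charExp h𝒜 ((OpenPartialHomeomorph.refl _).symm x))) =
      fun x : InfChar K H B => x := funext (charLog_charExp h𝒜)
  rw [h3]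
  exact isClassOn_id_infChar _ _

theorem isClassMapOn_charLog [ContinuousSMul K B] (r : WithTop ℕ∞) :
    letI := charChartedSpace (B := B) h𝒜
    IsClassMapOn K (InfChar K H B) (InfChar K H B) r (charLog (B := B) h𝒜) Set.univ := by
  let := charChartedSpace (B := B) h𝒜
  refine ⟨(continuous_charLog h𝒜).continuousOn, fun e he e' he' => ?_⟩
  have h1 : e = logChart h𝒜 := he
  have h2 : e' = OpenPartialHomeomorph.refl _ := he'
  rw [h1, h2]
  have h3 : (fun x => OpenPartialHomeomorph.refl _ (charLog h𝒜 ((logChart h𝒜).symm x))) =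
      fun x : InfChar K H B => x := funext (charLog_charExp h𝒜)
  rw [h3]
  exact isClassOn_id_infChar _ _

theorem isClassMapOn_toConvAlg [ContinuousSMul K B] (r : WithTop ℕ∞) :
    letI := charChartedSpace (B := B) h𝒜
    IsClassMapOn K (InfChar K H B) (ConvAlg K H B) r
      (CharGroup.toConvAlg : CharGroup K H B → ConvAlg K H B) Set.univ := by
  let := charChartedSpace (B := B) h𝒜
  refine ⟨CharGroup.isInducing_toConvAlg.continuous.continuousOn, fun e he e' he' => ?_⟩
  have h1 : e = logChart h𝒜 := he
  have h2 : e' = OpenPartialHomeomorph.refl _ := he'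
  rw [h1, h2]
  exact (isPointwisePoly_convExp_coe h𝒜).isClassOn r _

theorem isKAnalyticDiffeo_charExp [ContinuousSMul K B] :
    letI := charChartedSpace (B := B) h𝒜
    IsKAnalyticDiffeo K (InfChar K H B) (InfChar K H B) (charExp (B := B) h𝒜)
      Set.univ Set.univ :=
  ⟨isOpen_univ, isOpen_univ, charLog h𝒜,
    ⟨fun x _ => charLog_charExp h𝒜 x, fun x _ => charExp_charLog h𝒜 x⟩, fun _ _ => trivial,
    fun _ _ => trivial, isClassMapOn_charExp h𝒜 ω, isClassMapOn_charLog h𝒜 ω⟩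

theorem isLieExponential_charExp [ContinuousSMul K B] :
    letI := charChartedSpace (B := B) h𝒜
    IsLieExponential K (InfChar K H B) (charExp (B := B) h𝒜) := by
  let := charChartedSpace (B := B) h𝒜
  refine ⟨isClassMapOn_charExp h𝒜 ∞, fun v s t => ?_, fun v => ?_⟩
  · rw [RCLike.ofReal_add, charExp_add_smul]
  · refine tendsto_const_nhds.congr' ?_
    filter_upwards [self_mem_nhdsWithin] with t ht
    change v = ((t : K)⁻¹) • (charLog h𝒜 (charExp h𝒜 ((t : K) • v)) - charLog h𝒜 1)
    rw [charLog_charExp, charLog_one, sub_zero, inv_smul_smul₀ (RCLike.ofReal_ne_zero.2 ht)]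

theorem lieGroupBracket_eq [ContinuousSMul K B] (v w : InfChar K H B) :
    letI := charChartedSpace (B := B) h𝒜
    lieGroupBracket K (InfChar K H B) (CharGroup K H B) v w = ⁅v, w⁆ := by
  let := charChartedSpace (B := B) h𝒜
  have hone : chartAt (InfChar K H B) (1 : CharGroup K H B) 1 = 0 := charLog_one h𝒜
  have hfield (v : InfChar K H B) : leftInvariantField K (InfChar K H B) (CharGroup K H B) v =
      fun x => dirDeriv K (fun y => bchMul h𝒜 x y) 0 v := by
    funext x
    rw [leftInvariantField, hone]
    rfl
  obtain ⟨h1, h2⟩ := hasDirDeriv_dirDeriv_bchMul h𝒜 v w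
  obtain ⟨h3, h4⟩ := hasDirDeriv_dirDeriv_bchMul h𝒜 w v
  rw [lieGroupBracket, fieldBracket, hone, hfield, hfield]
  simp only [h2, h4]
  rw [h1.dirDeriv_eq, h3.dirDeriv_eq, ← lie_skew w v, smul_neg, sub_neg_eq_add, ← add_smul]
  norm_num

end LieGroup

end

theorem theorem2p6 {K : Type*} [RCLike K] {H : Type*} [Ring H] [HopfAlgebra K H]
    (𝒜 : ℕ → Submodule K H) (h𝒜 : IsConnectedHopfGrading 𝒜)
    {B : Type*} [CommRing B] [Algebra K B] [TopologicalSpace B] [IsTopologicalRing B]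
    (hB : IsLocallyConvexTVS K B) :
    (∃ _ : ChartedSpace (InfChar K H B) (CharGroup K H B),
      -- `Char(H, B)` is a `K`-analytic Lie group modelled on the infinitesimal characters
      IsKAnalyticLieGroup K (InfChar K H B) (CharGroup K H B) ∧
      -- the inclusion of `Char(H, B)` into `Hom_K(H, B)` is `K`-analytic
      IsClassMapOn K (InfChar K H B) (ConvAlg K H B) ω
        (CharGroup.toConvAlg (K := K) (H := H) (B := B)) Set.univ ∧
      -- its tangent map at `1` identifies the Lie algebra of the group, as a topological Lie
      -- algebra, with the infinitesimal characters
      ∃ L : TangentAtOne (InfChar K H B) (CharGroup K H B) ≃L[K] InfChar K H B,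
        (∀ v, HasDirDeriv K
          (fun x => CharGroup.toConvAlg
            ((chartAt (InfChar K H B) (1 : CharGroup K H B)).symm x))
          (chartAt (InfChar K H B) (1 : CharGroup K H B) 1) v (L v : ConvAlg K H B)) ∧
        (∀ v w, L (lieGroupBracket K (InfChar K H B) (CharGroup K H B) v w) = ⁅L v, L w⁆) ∧
        -- it is a BCH Lie group, which is exponential with exponential map given by the
        -- exponential series
        IsBCHLieGroup K (InfChar K H B) (CharGroup K H B) ∧
        ∃ exp : TangentAtOne (InfChar K H B) (CharGroup K H B) → CharGroup K H B,
          IsLieExponential K (InfChar K H B) exp ∧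
          IsKAnalyticDiffeo K (InfChar K H B) (InfChar K H B) exp Set.univ Set.univ ∧
          ∀ v, HasSum (fun n : ℕ => ((n.factorial : K)⁻¹) • (L v : ConvAlg K H B) ^ n)
            (CharGroup.toConvAlg (exp v))) ∧
    -- properties of the model space
    (Module.rank K H ≤ Cardinal.aleph0 → IsFrechet K B → IsFrechet K (InfChar K H B)) ∧
    (IsWeaklyComplete K B → IsWeaklyComplete K (InfChar K H B)) := by
  have := hB.continuousSMul
  have := hB.t2
  obtain ⟨ι, h, Φ, -, hι⟩ := InfChar.exists_equiv_pi K H B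
  refine ⟨⟨charChartedSpace h𝒜, isKAnalyticLieGroup_charGroup h𝒜 hB, isClassMapOn_toConvAlg h𝒜 ω,
    ContinuousLinearEquiv.refl K _, fun v => ?_, lieGroupBracket_eq h𝒜,
    ⟨isKAnalyticLieGroup_charGroup h𝒜 hB, charExp h𝒜, isLieExponential_charExp h𝒜, Set.univ,
      Set.univ, trivial, isKAnalyticDiffeo_charExp h𝒜⟩, charExp h𝒜, isLieExponential_charExp h𝒜,
    isKAnalyticDiffeo_charExp h𝒜, fun v => hasSum_convExp h𝒜 (InfChar.mem_vanishBelow h𝒜 v.2)⟩,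
    fun hH hF => ?_, fun hW => hW.of_equiv_pi Φ⟩
  · change HasDirDeriv K (fun x : InfChar K H B => convExp (x : ConvAlg K H B)) (charLog h𝒜 1) v
      (v : ConvAlg K H B)
    rw [charLog_one]
    exact hasDirDeriv_convExp_zero h𝒜 (InfChar.mem_vanishBelow h𝒜 v.2)
  · have : Countable ι := Cardinal.mk_le_aleph0_iff.1 (hι.trans hH)
    exact hF.of_equiv_pi Φ
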